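/- Let $k$ be a field, $A$ a $k$-algebra and $H$ a left bialgebroid over $A$: a $k$-algebra $H$ with an algebra map $A\otimes_k A^{op}\to H$ (write $a$ and $\bar a$ for the images of $a\otimes 1$ and $1\otimes a$; every left $H$-module $M$ becomes an $A$-bimodule by $r\,m\,s=(r\bar s)\triangleright m$, and $\otimes_A$ denotes the tensor product of these bimodules), together with $A$-bimodule maps $\Delta:H\to H\otimes_A H$, $\Delta(h)=h_{(1)}\otimes h_{(2)}$, and $\epsilon:H\to A$ (for left multiplication on $H$) that make $H$ a coalgebra in $A$-bimodules and satisfy $\Delta(br\bar s)=b_{(1)}r\otimes b_{(2)}\bar s$, $\epsilon(br)=\epsilon(b\bar r)$, $\Delta(bb')=b_{(1)}b'_{(1)}\otimes b_{(2)}b'_{(2)}$, $\Delta(1)=1\otimes 1$, $\epsilon(1)=1$ and $\epsilon(bb')=\epsilon(b\,\epsilon(b'))=\epsilon(b\,\overline{\epsilon(b')})$. The category of left $H$-modules is monoidal for $\otimes_A$, with $h\triangleright(m\otimes n)=h_{(1)}\triangleright m\otimes h_{(2)}\triangleright n$ and with unit $A$, $h\triangleright a=\epsilon(ha)$. Let $H\boxtimes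 A=H\otimes_{A\otimes_k A^{op}}A$, that is $H\otimes_k A$ modulo $br\bar s\otimes a=b\otimes ras$, with the left $H$-action by multiplication on $H$. 1. $h\boxtimes a\mapsto [ha]$ is an isomorphism of left $H$-modules from $H\boxtimes A$ to the quotient of $H$ by the left ideal generated by $\{a-\bar a\mid a\in A\}$. 2. The formulas $\Delta(h\boxtimes a)=(h_{(1)}\boxtimes a)\otimes(h_{(2)}\boxtimes 1)$ and $\epsilon(h\boxtimes a)=\epsilon(ha)$ define a coalgebra structure on $H\boxtimes A$ in the monoidal category of left $H$-modules. 3. Suppose that $H$ is left Hopf, that is, the map $\beta:H\otimes_{A^{op}}H\to H\otimes_A H$, $\beta(b\otimes b')=b_{(1)}\otimes b_{(2)}b'$, is bijective, where $H\otimes_{A^{op}}H$ is $H\otimes_k H$ modulo $b\bar s\otimes b'=b\otimes\bar s b'$; write $\beta^{-1}(h\otimes 1)=h_{(+)}\otimes h_{(-)}$. Then the maps $$\tau_M:(H\boxtimes A)\otimes_A M\to M\otimes_A(H\boxtimes A),\qquad (h\boxtimes a)\otimes m\mapsto \big(h_{(+)(1)}\,a\,h_{(-)}\big)\triangleright m\otimes\big(h_{(+)(2)}\boxtimes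 1\big),$$ for all left $H$-modules $M$, are well defined and $H$-linear and form a lax braiding $\tau$ for $C=H\boxtimes A$: a natural transformation $\tau: C\otimes_A -\to -\otimes_A C$, not required to be invertible, with $\tau_{M\otimes N}=(\mathrm{id}_M\otimes\tau_N)(\tau_M\otimes\mathrm{id}_N)$ and $\tau_A=\mathrm{id}_C$ (up to the unit constraints). With it, $C$ is a lax cocommutative central coalgebra: $(\tau_M\otimes\mathrm{id}_C)(\mathrm{id}_C\otimes\tau_M)(\Delta\otimes\mathrm{id}_M)=(\mathrm{id}_M\otimes\Delta)\tau_M$ and $(\mathrm{id}_M\otimes\epsilon)\tau_M=\epsilon\otimes\mathrm{id}_M$ for all $M$, and $\tau_C\Delta=\Delta$. -/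

import Mathlib

open CategoryTheory MonoidalCategory
open scoped TensorProduct

universe v u

noncomputable section

namespace HopfAlgebroid

/-! ### Balanced tensor products of abelian groups -/

section Balanced

variable {ι κ M N P M' N' : Type*} [AddCommGroup M] [AddCommGroup N] [AddCommGroup P]
  [AddCommGroup M'] [AddCommGroup N']

/-- The relations `(ρ i m) ⊗ n = m ⊗ (l i n)`. -/
def balancedRel (ρ : ι → M →+ M) (l : ι → N →+ N) : Submodule ℤ (TensorProduct ℤ M N) :=
  Submodule.span ℤ {x | ∃ i m n, x = ρ i m ⊗ₜ[ℤ] n - m ⊗ₜ[ℤ] l i n}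

/-- The tensor product of the abelian groups `M` and `N`, balanced over a family of operators acting
on `M` through `ρ` and on `N` through `l`. When these are the right action of a ring `R` on `M` and
its left action on `N`, this is `M ⊗_R N`. If `R` is an algebra over a field `k`, then the relations
contain `λ m ⊗ n = m ⊗ λ n` for `λ ∈ k`, so the same group is a quotient of `M ⊗_k N`. -/
def Balanced (ρ : ι → M →+ M) (l : ι → N →+ N) : Type _ :=
  TensorProduct ℤ M N ⧸ balancedRel ρ l

namespace Balanced

instance (ρ : ι → M →+ M) (l : ι → N →+ N) : AddCommGroup (Balanced ρ l) :=
  inferInstanceAs (AddCommGroup (TensorProduct ℤ M N ⧸ balancedRel ρ l))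

variable {ρ : ι → M →+ M} {l : ι → N →+ N} {ρ' : ι → M' →+ M'} {l' : ι → N' →+ N'}

/-- The class of the pure tensor `m ⊗ n`. -/
def tmul (m : M) (n : N) : Balanced ρ l := (balancedRel ρ l).mkQ (m ⊗ₜ[ℤ] n)

theorem balance (i : ι) (m : M) (n : N) :
    (tmul (ρ i m) n : Balanced ρ l) = tmul m (l i n) := by
  refine (Submodule.Quotient.eq _).2 (Submodule.subset_span ⟨i, m, n, rfl⟩)

theorem add_tmul (m m' : M) (n : N) :
    (tmul (m + m') n : Balanced ρ l) = tmul m n + tmul m' n := by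
  unfold tmul
  rw [TensorProduct.add_tmul]
  exact map_add _ _ _

theorem tmul_add (m : M) (n n' : N) :
    (tmul m (n + n') : Balanced ρ l) = tmul m n + tmul m n' := by
  unfold tmul
  rw [TensorProduct.tmul_add]
  exact map_add _ _ _

theorem hom_ext {f g : Balanced ρ l →+ P} (h : ∀ m n, f (tmul m n) = g (tmul m n)) : f = g := by
  let q : TensorProduct ℤ M N →+ Balanced ρ l := (balancedRel ρ l).mkQ.toAddMonoidHom
  have e : f.comp q = g.comp q := by
    ext y
    induction y with
    | zero => simp
    | tmul m n => exact h m n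
    | add a b ha hb => rw [map_add, map_add, ha, hb]
  ext x
  obtain ⟨y, rfl⟩ := Submodule.mkQ_surjective (balancedRel ρ l) x
  exact DFunLike.congr_fun e y

theorem fun_ext {f g : Balanced ρ l →+ P} (h : ∀ m n, f (tmul m n) = g (tmul m n))
    (x : Balanced ρ l) : f x = g x := DFunLike.congr_fun (hom_ext h) x

/-- The additive map out of `M ⊗ N` given by a balanced biadditive map. -/
def lift (f : M →+ N →+ P) (hf : ∀ i m n, f (ρ i m) n = f m (l i n)) : Balanced ρ l →+ P :=
  ((balancedRel ρ l).liftQ (TensorProduct.liftAddHom f (fun r m n => by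
      rw [map_zsmul, map_zsmul]; rfl)).toIntLinearMap (by
    refine Submodule.span_le.2 ?_
    rintro _ ⟨i, m, n, rfl⟩
    simp [hf])).toAddMonoidHom

@[simp] theorem lift_tmul (f : M →+ N →+ P) (hf : ∀ i m n, f (ρ i m) n = f m (l i n))
    (m : M) (n : N) : lift f hf (tmul m n : Balanced ρ l) = f m n := rfl

/-- The biadditive map `(m, n) ↦ m ⊗ n`. -/
def mk₂ (ρ : ι → M →+ M) (l : ι → N →+ N) : M →+ N →+ Balanced ρ l :=
  AddMonoidHom.mk' (fun m => AddMonoidHom.mk' (fun n => tmul m n) (tmul_add m))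
    (fun m m' => by ext n; exact add_tmul m m' n)

@[simp] theorem mk₂_apply (m : M) (n : N) : mk₂ ρ l m n = tmul m n := rfl

/-- `f ⊗ g` for maps that commute with the operators. -/
def map (f : M →+ M') (hf : ∀ i m, f (ρ i m) = ρ' i (f m))
    (g : N →+ N') (hg : ∀ i n, g (l i n) = l' i (g n)) : Balanced ρ l →+ Balanced ρ' l' :=
  lift (((mk₂ ρ' l').comp f).compl₂ g) (fun i m n => by
    simp [hf, hg, balance])

@[simp] theorem map_tmul (f : M →+ M') (hf : ∀ i m, f (ρ i m) = ρ' i (f m))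
    (g : N →+ N') (hg : ∀ i n, g (l i n) = l' i (g n)) (m : M) (n : N) :
    map f hf g hg (tmul m n : Balanced ρ l) = (tmul (f m) (g n) : Balanced ρ' l') := rfl

section assoc

variable {ρN : κ → N →+ N} {lP : κ → P →+ P}
  (ρMN : κ → Balanced ρ l →+ Balanced ρ l)
  (hρ : ∀ j m n, ρMN j (tmul m n) = tmul m (ρN j n))
  (lNP : ι → Balanced ρN lP →+ Balanced ρN lP)
  (hl : ∀ i n p, lNP i (tmul n p) = tmul (l i n) p)

/-- `(m, n) ↦ (p ↦ m ⊗ (n ⊗ p))`, balanced in `m` and `n`. -/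
def assocHomAux : Balanced ρ l →+ P →+ Balanced ρ lNP :=
  lift
    (AddMonoidHom.mk' (fun m => AddMonoidHom.mk' (fun n => (mk₂ ρ lNP m).comp (mk₂ ρN lP n))
        (fun n n' => by ext p; simp [tmul_add]))
      (fun m m' => by ext n p; simp))
    (fun i m n => by
      ext p
      exact (balance i m (tmul n p)).trans (congrArg (tmul m) (hl i n p)))

/-- `(m ⊗ n) ⊗ p ↦ m ⊗ (n ⊗ p)`; here `ρMN` is the right action on `M ⊗ N` through `N`, and `lNP`
is the left action on `N ⊗ P` through `N`. -/
def assocHom : Balanced ρMN lP →+ Balanced ρ lNP :=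
  lift (assocHomAux lNP hl) (fun j x p =>
    fun_ext (f := ((assocHomAux lNP hl).flip p).comp (ρMN j))
      (g := (assocHomAux lNP hl).flip (lP j p))
      (fun m n => by
        change assocHomAux lNP hl (ρMN j (tmul m n)) p = _
        rw [hρ]
        exact congrArg (tmul m) (balance j n p)) x)

@[simp] theorem assocHom_tmul (m : M) (n : N) (p : P) :
    assocHom ρMN hρ lNP hl (tmul (tmul m n) p) = tmul m (tmul n p) := rfl

/-- `m ↦ (n ⊗ p ↦ (m ⊗ n) ⊗ p)`. -/
def assocInvAux : M →+ Balanced ρN lP →+ Balanced ρMN lP :=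
  AddMonoidHom.mk' (fun m => lift
      (AddMonoidHom.mk' (fun n => mk₂ ρMN lP (tmul m n)) (fun n n' => by
        ext p; simp [tmul_add]))
      (fun j n p => by
        change tmul (tmul m (ρN j n)) p = tmul (tmul m n) (lP j p)
        rw [← hρ, balance]))
    (fun m m' => hom_ext (fun n p => by simp [add_tmul]))

/-- `m ⊗ (n ⊗ p) ↦ (m ⊗ n) ⊗ p`. -/
def assocInv : Balanced ρ lNP →+ Balanced ρMN lP :=
  lift (assocInvAux ρMN hρ) (fun i m x =>
    fun_ext (f := assocInvAux ρMN hρ (ρ i m)) (g := (assocInvAux ρMN hρ m).comp (lNP i))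
      (fun n p => by
        change tmul (tmul (ρ i m) n) p = assocInvAux ρMN hρ m (lNP i (tmul n p))
        rw [hl, balance]
        rfl) x)

@[simp] theorem assocInv_tmul (m : M) (n : N) (p : P) :
    assocInv ρMN hρ lNP hl (tmul m (tmul n p)) = tmul (tmul m n) p := rfl

/-- Two additive maps out of `(M ⊗ N) ⊗ P` agree if they agree on pure tensors. -/
theorem hom_ext₃ {Q : Type*} [AddCommGroup Q] {f g : Balanced ρMN lP →+ Q}
    (h : ∀ m n p, f (tmul (tmul m n) p) = g (tmul (tmul m n) p)) : f = g := by
  refine hom_ext fun x p => ?_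
  exact fun_ext (f := f.comp ((mk₂ ρMN lP).flip p)) (g := g.comp ((mk₂ ρMN lP).flip p))
    (fun m n => h m n p) x

/-- Two additive maps out of `M ⊗ (N ⊗ P)` agree if they agree on pure tensors. -/
theorem hom_ext₃' {Q : Type*} [AddCommGroup Q] {f g : Balanced ρ lNP →+ Q}
    (h : ∀ m n p, f (tmul m (tmul n p)) = g (tmul m (tmul n p))) : f = g := by
  refine hom_ext fun m x => ?_
  exact fun_ext (f := f.comp (mk₂ ρ lNP m)) (g := g.comp (mk₂ ρ lNP m))
    (fun n p => h m n p) x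

end assoc

end Balanced

end Balanced

/-! ### `A^e`-rings and the tensor product over `A` -/

section AeRing

variable {k : Type v} {A H : Type*} [CommRing k] [Ring A] [Algebra k A] [Ring H] [Algebra k H]
  (η : A ⊗[k] Aᵐᵒᵖ →ₐ[k] H)

/-- The source map `a ↦ η (a ⊗ 1)`; its value is written `a` when the algebra map `η : A^e → H` is
suppressed. -/
def src (a : A) : H := η (a ⊗ₜ[k] 1)

/-- The target map `a ↦ η (1 ⊗ a)`; its value is written `ā`. -/
def tgt (a : A) : H := η (1 ⊗ₜ[k] MulOpposite.op a)

theorem src_add (a b : A) : src η (a + b) = src η a + src η b := by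
  simp [src, TensorProduct.add_tmul]

theorem tgt_add (a b : A) : tgt η (a + b) = tgt η a + tgt η b := by
  simp [tgt, TensorProduct.tmul_add]

theorem src_mul (a b : A) : src η (a * b) = src η a * src η b := by
  simp [src, ← map_mul]

theorem tgt_mul (a b : A) : tgt η (a * b) = tgt η b * tgt η a := by
  simp [tgt, ← map_mul]

theorem src_one : src η 1 = 1 := map_one η

theorem tgt_one : tgt η 1 = 1 := map_one η

theorem src_tgt_comm (a b : A) : src η a * tgt η b = tgt η b * src η a := by
  simp [src, tgt, ← map_mul]

variable (M : Type*) [AddCommGroup M] [Module H M] {M' : Type*} [AddCommGroup M'] [Module H M']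
  (N : Type*) [AddCommGroup N] [Module H N] {N' : Type*} [AddCommGroup N'] [Module H N']
  {L : Type*} [AddCommGroup L] [Module H L]

/-- The left `A`-action `m ↦ a m` on an `H`-module, regarded as an `A`-bimodule through `η`. -/
def lAct (a : A) : M →+ M := DistribSMul.toAddMonoidHom M (src η a)

/-- The right `A`-action `m ↦ m a = ā m` on an `H`-module. -/
def rAct (a : A) : M →+ M := DistribSMul.toAddMonoidHom M (tgt η a)

variable {M N} in
@[simp] theorem lAct_apply (a : A) (m : M) : lAct η M a m = src η a • m := rfl

variable {M N} in
@[simp] theorem rAct_apply (a : A) (m : M) : rAct η M a m = tgt η a • m := rfl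

/-- `M ⊗_A N` for `H`-modules `M` and `N`, regarded as `A`-bimodules. -/
abbrev Tens : Type _ := Balanced (rAct η M) (lAct η N)

variable {M N}

/-- `m ⊗ n` in `M ⊗_A N`. -/
abbrev Tens.tmul (m : M) (n : N) : Tens η M N := Balanced.tmul m n

theorem Tens.balance (a : A) (m : M) (n : N) :
    Tens.tmul η (tgt η a • m) n = Tens.tmul η m (src η a • n) :=
  Balanced.balance (ρ := rAct η M) (l := lAct η N) a m n

/-- `f ⊗ g` for `H`-linear maps, as a map of abelian groups. -/
def Tens.map (f : M →ₗ[H] M') (g : N →ₗ[H] N') : Tens η M N →+ Tens η M' N' :=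
  Balanced.map f.toAddMonoidHom (fun a m => f.map_smul (tgt η a) m)
    g.toAddMonoidHom (fun a n => g.map_smul (src η a) n)

@[simp] theorem Tens.map_tmul (f : M →ₗ[H] M') (g : N →ₗ[H] N') (m : M) (n : N) :
    Tens.map η f g (Tens.tmul η m n) = Tens.tmul η (f m) (g n) := rfl

variable (M N) in
/-- The left `A`-action on `M ⊗_A N` through `M`. -/
def Tens.lAct (a : A) : Tens η M N →+ Tens η M N :=
  Balanced.map (HopfAlgebroid.lAct η M a)
    (fun b m => by simp only [lAct_apply, rAct_apply, smul_smul, src_tgt_comm])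
    (AddMonoidHom.id N) (fun _ _ => rfl)

variable (M N) in
/-- The right `A`-action on `M ⊗_A N` through `N`. -/
def Tens.rAct (a : A) : Tens η M N →+ Tens η M N :=
  Balanced.map (AddMonoidHom.id M) (fun _ _ => rfl)
    (HopfAlgebroid.rAct η N a)
    (fun b m => by simp only [lAct_apply, rAct_apply, smul_smul, src_tgt_comm])

@[simp] theorem Tens.lAct_tmul (a : A) (m : M) (n : N) :
    Tens.lAct η M N a (Tens.tmul η m n) = Tens.tmul η (src η a • m) n := rfl

@[simp] theorem Tens.rAct_tmul (a : A) (m : M) (n : N) :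
    Tens.rAct η M N a (Tens.tmul η m n) = Tens.tmul η m (tgt η a • n) := rfl

/-- `M ⊗_A (N ⊗_A L)`. -/
abbrev TensR (M N L : Type*) [AddCommGroup M] [Module H M] [AddCommGroup N] [Module H N]
    [AddCommGroup L] [Module H L] : Type _ :=
  Balanced (rAct η M) (Tens.lAct η N L)

/-- `(M ⊗_A N) ⊗_A L`. -/
abbrev TensL (M N L : Type*) [AddCommGroup M] [Module H M] [AddCommGroup N] [Module H N]
    [AddCommGroup L] [Module H L] : Type _ :=
  Balanced (Tens.rAct η M N) (lAct η L)

/-- The associativity constraint `(m ⊗ n) ⊗ l ↦ m ⊗ (n ⊗ l)`. -/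
def Tens.assoc : TensL η M N L →+ TensR η M N L :=
  Balanced.assocHom (Tens.rAct η M N) (Tens.rAct_tmul η) (Tens.lAct η N L) (Tens.lAct_tmul η)

@[simp] theorem Tens.assoc_tmul (m : M) (n : N) (l : L) :
    Tens.assoc η (Balanced.tmul (Tens.tmul η m n) l : TensL η M N L) =
      Balanced.tmul m (Tens.tmul η n l) := rfl

variable (H) in
/-- Right multiplication `b ↦ b c`, a map of left `H`-modules; more generally `b ↦ b m`. -/
abbrev orb (m : M) : H →ₗ[H] M := LinearMap.toSpanSingleton H M m

theorem Tens.map_add_left (f f' : M →ₗ[H] M') (g : N →ₗ[H] N') (x : Tens η M N) :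
    Tens.map η (f + f') g x = Tens.map η f g x + Tens.map η f' g x :=
  Balanced.fun_ext (f := Tens.map η (f + f') g) (g := Tens.map η f g + Tens.map η f' g)
    (fun _ _ => Balanced.add_tmul _ _ _) x

theorem Tens.map_add_right (f : M →ₗ[H] M') (g g' : N →ₗ[H] N') (x : Tens η M N) :
    Tens.map η f (g + g') x = Tens.map η f g x + Tens.map η f g' x :=
  Balanced.fun_ext (f := Tens.map η f (g + g')) (g := Tens.map η f g + Tens.map η f g')
    (fun _ _ => Balanced.tmul_add _ _ _) x

theorem Tens.map_map {M'' N'' : Type*} [AddCommGroup M''] [Module H M''] [AddCommGroup N'']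
    [Module H N''] (f : M →ₗ[H] M') (g : N →ₗ[H] N') (f' : M' →ₗ[H] M'') (g' : N' →ₗ[H] N'')
    (x : Tens η M N) :
    Tens.map η f' g' (Tens.map η f g x) = Tens.map η (f'.comp f) (g'.comp g) x :=
  Balanced.fun_ext (f := (Tens.map η f' g').comp (Tens.map η f g))
    (g := Tens.map η (f'.comp f) (g'.comp g)) (fun _ _ => rfl) x

theorem Tens.map_id (x : Tens η M N) : Tens.map η LinearMap.id LinearMap.id x = x :=
  Balanced.fun_ext (f := Tens.map η LinearMap.id LinearMap.id) (g := AddMonoidHom.id (Tens η M N))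
    (fun _ _ => rfl) x

/-- `b ⊗ b' ↦ ε(b) b'`. -/
def counitLeft (ε : H →+ A) (h : ∀ a b, ε (tgt η a * b) = ε b * a) : Tens η H H →+ H :=
  Balanced.lift
    (AddMonoidHom.mk' (fun b => AddMonoidHom.mulLeft (src η (ε b)))
      (fun b b' => by ext c; simp [src_add, add_mul]))
    (fun a b c => by simp [h, src_mul, mul_assoc])

/-- `b ⊗ b' ↦ \overline{ε(b')} b`. -/
def counitRight (ε : H →+ A) (h : ∀ a b, ε (src η a * b) = a * ε b) : Tens η H H →+ H :=
  Balanced.lift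
    (AddMonoidHom.mk' (fun b => AddMonoidHom.mk' (fun b' => tgt η (ε b') * b)
        (fun c c' => by simp [tgt_add, add_mul]))
      (fun b b' => by ext c; simp [mul_add]))
    (fun a b c => by simp [h, tgt_mul, mul_assoc])

/-- `Δ ⊗ id : H ⊗_A H → (H ⊗_A H) ⊗_A H`. -/
def comulTensor (Δ : H →+ Tens η H H)
    (h : ∀ a b, Δ (tgt η a * b) = Tens.rAct η H H a (Δ b)) : Tens η H H →+ TensL η H H H :=
  Balanced.map Δ h (AddMonoidHom.id H) (fun _ _ => rfl)

/-- `id ⊗ Δ : H ⊗_A H → H ⊗_A (H ⊗_A H)`. -/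
def tensorComul (Δ : H →+ Tens η H H)
    (h : ∀ a b, Δ (src η a * b) = Tens.lAct η H H a (Δ b)) : Tens η H H →+ TensR η H H H :=
  Balanced.map (AddMonoidHom.id H) (fun _ _ => rfl) Δ h

/-- An `A|A`-coring structure on an `A^e`-ring `H`. -/
structure Coring where
  /-- The comultiplication `Δ : |H → |H ⊗_A |H`. -/
  comul : H →+ Tens η H H
  /-- The counit `ε : |H → A`. -/
  counit : H →+ A
  /-- `Δ` is a map of left `A`-modules. -/
  comul_left : ∀ a b, comul (src η a * b) = Tens.lAct η H H a (comul b)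
  /-- `Δ` is a map of right `A`-modules. -/
  comul_right : ∀ a b, comul (tgt η a * b) = Tens.rAct η H H a (comul b)
  /-- `ε` is a map of left `A`-modules. -/
  counit_left : ∀ a b, counit (src η a * b) = a * counit b
  /-- `ε` is a map of right `A`-modules. -/
  counit_right : ∀ a b, counit (tgt η a * b) = counit b * a
  /-- `(Δ ⊗ id) Δ = (id ⊗ Δ) Δ`. -/
  coassoc : ∀ b,
    Tens.assoc η (comulTensor η comul comul_right (comul b)) =
      tensorComul η comul comul_left (comul b)
  /-- `ε(b₁) b₂ = b`. -/
  counit_comul : ∀ b, counitLeft η counit counit_right (comul b) = b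
  /-- `\overline{ε(b₂)} b₁ = b`. -/
  comul_counit : ∀ b, counitRight η counit counit_left (comul b) = b
  /-- `Δ(b r s̄) = b₁ r ⊗ b₂ s̄`. -/
  comul_mul_right : ∀ b r s,
    comul (b * src η r * tgt η s) = Tens.map η (orb H (src η r)) (orb H (tgt η s)) (comul b)
  /-- `ε(b r) = ε(b r̄)`. -/
  counit_mul_right : ∀ b r, counit (b * src η r) = counit (b * tgt η r)

namespace Coring

variable {η} (C : Coring η)

/-- The image of `Δ` lies in the Takeuchi product: `b₁ ā ⊗ b₂ = b₁ ⊗ b₂ a`. -/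
theorem takeuchi (a : A) (b : H) :
    Tens.map η (orb H (tgt η a)) LinearMap.id (C.comul b) =
      Tens.map η LinearMap.id (orb H (src η a)) (C.comul b) := by
  let φ : Tens η H H →+ H := (counitLeft η C.counit C.counit_right).comp
    (Tens.map η (orb H (src η a)) LinearMap.id)
  let ψ : Tens η H H →+ H := (counitRight η C.counit C.counit_left).comp
    (Tens.map η LinearMap.id (orb H (tgt η a)))
  have hφ : ∀ c, φ (C.comul c) = c * src η a := fun c => by
    have h := C.counit_comul (c * src η a * tgt η 1)
    rw [C.comul_mul_right, tgt_one, mul_one] at h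
    rw [← h]
    have e : orb H (1 : H) = LinearMap.id := by ext; simp
    rw [e]; rfl
  have hψ : ∀ c, ψ (C.comul c) = c * tgt η a := fun c => by
    have h := C.comul_counit (c * src η 1 * tgt η a)
    rw [C.comul_mul_right, src_one, mul_one] at h
    rw [← h]
    have e : orb H (1 : H) = LinearMap.id := by ext; simp
    rw [e]; rfl
  have hφA : ∀ r x, φ (Tens.lAct η H H r x) = lAct η H r (φ x) := fun r =>
    Balanced.fun_ext (f := φ.comp (Tens.lAct η H H r)) (g := (lAct η H r).comp φ) fun m n => by
      change src η (C.counit ((src η r * m) * src η a)) * n = src η r * (src η _ * n)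
      rw [mul_assoc, C.counit_left, src_mul, mul_assoc]
      rfl
  have hψA : ∀ r x, ψ (Tens.rAct η H H r x) = rAct η H r (ψ x) := fun r =>
    Balanced.fun_ext (f := ψ.comp (Tens.rAct η H H r)) (g := (rAct η H r).comp ψ) fun m n => by
      change tgt η (C.counit ((tgt η r * n) * tgt η a)) * m = tgt η r * (tgt η _ * m)
      rw [mul_assoc, C.counit_right, tgt_mul, mul_assoc]
      rfl
  let Ω : TensR η H H H →+ Tens η H H :=
    Balanced.map (AddMonoidHom.id H) (fun _ _ => rfl) φ hφA
  let Ω' : TensL η H H H →+ Tens η H H :=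
    Balanced.map ψ hψA (AddMonoidHom.id H) (fun _ _ => rfl)
  have key : ∀ x, Ω (Tens.assoc η x) = Ω' x := fun x =>
    DFunLike.congr_fun (f := Ω.comp (Tens.assoc η)) (g := Ω')
      (Balanced.hom_ext₃ _ fun m n p => by
        change Tens.tmul η m (src η (C.counit (n * src η a)) • p) =
          Tens.tmul η (tgt η (C.counit (n * tgt η a)) • m) p
        rw [Tens.balance, C.counit_mul_right]) x
  have h := congrArg Ω (C.coassoc b)
  rw [key] at h
  have e1 : ∀ x : Tens η H H, Ω' (comulTensor η C.comul C.comul_right x) = Tens.map η (orb H (tgt η a)) LinearMap.id x := fun x =>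
    Balanced.fun_ext (f := Ω'.comp (comulTensor η C.comul C.comul_right)) (g := Tens.map η (orb H (tgt η a)) LinearMap.id) (fun m n => by
        change Tens.tmul η (ψ (C.comul m)) n = Tens.tmul η (m * tgt η a) n
        rw [hψ]) x
  have e2 : ∀ x : Tens η H H, Ω (tensorComul η C.comul C.comul_left x) = Tens.map η LinearMap.id (orb H (src η a)) x := fun x =>
    Balanced.fun_ext (f := Ω.comp (tensorComul η C.comul C.comul_left)) (g := Tens.map η LinearMap.id (orb H (src η a))) (fun m n => by
        change Tens.tmul η m (φ (C.comul n)) = Tens.tmul η m (n * src η a)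
        rw [hφ]) x
  rw [e1, e2] at h
  exact h

/-- The map `m ⊗ n ↦ b₁ m ⊗ b₂ n` on `M ⊗_A N`. -/
def act (b : H) : Tens η M N →+ Tens η M N :=
  Balanced.lift
    (AddMonoidHom.mk' (fun m => AddMonoidHom.mk'
        (fun n => Tens.map η (orb H m) (orb H n) (C.comul b))
        (fun n n' => by
          rw [← Tens.map_add_right]; congr 2; ext; simp))
      (fun m m' => by
        ext n
        change Tens.map η _ _ _ = Tens.map η _ _ _ + Tens.map η _ _ _
        rw [← Tens.map_add_left]; congr 2; ext; simp))
    (fun a m n => by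
      have h := congrArg (Tens.map η (orb H m) (orb H n)) (C.takeuchi a b)
      rw [Tens.map_map, Tens.map_map] at h
      have e1 : (orb H m).comp (orb H (tgt η a)) = orb H (rAct η M a m) := by ext; simp
      have e2 : (orb H n).comp (orb H (src η a)) = orb H (lAct η N a n) := by ext; simp
      rw [e1, e2, LinearMap.comp_id, LinearMap.comp_id] at h
      exact h)

@[simp] theorem act_tmul (b : H) (m : M) (n : N) :
    C.act b (Tens.tmul η m n) = Tens.map η (orb H m) (orb H n) (C.comul b) := rfl

end Coring

end AeRing

/-- A left bialgebroid `H` over the `k`-algebra `A`. In the multiplicativity axiom, `act b` is the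
map `x ⊗ y ↦ b₁ x ⊗ b₂ y` on `H ⊗_A H`, which is well defined since `Δ(b)` lies in the Takeuchi
product. -/
structure LeftBialgebroid (k : Type v) (A H : Type u) [CommRing k] [Ring A] [Algebra k A] [Ring H]
    [Algebra k H] where
  /-- The algebra map `A^e → H` that makes `H` an `A^e`-ring. -/
  η : A ⊗[k] Aᵐᵒᵖ →ₐ[k] H
  /-- The `A|A`-coring structure. -/
  coring : Coring η
  /-- `Δ(b b') = b₁ b'₁ ⊗ b₂ b'₂`. -/
  comul_mul : ∀ b b', coring.comul (b * b') = coring.act b (coring.comul b')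
  /-- `Δ(1) = 1 ⊗ 1`. -/
  comul_one : coring.comul 1 = Tens.tmul η 1 1
  /-- `ε(1) = 1`. -/
  counit_one : coring.counit 1 = 1
  /-- `ε(b b') = ε(b ε(b'))`. -/
  counit_mul_src : ∀ b b',
    coring.counit (b * b') = coring.counit (b * src η (coring.counit b'))
  /-- `ε(b b') = ε(b \overline{ε(b')})`. -/
  counit_mul_tgt : ∀ b b',
    coring.counit (b * b') = coring.counit (b * tgt η (coring.counit b'))

namespace LeftBialgebroid

variable {k : Type v} {A H : Type u} [CommRing k] [Ring A] [Algebra k A] [Ring H] [Algebra k H]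
  (B : LeftBialgebroid k A H)

/-- The source map of `B`. -/
abbrev s (a : A) : H := src B.η a

/-- The target map of `B`. -/
abbrev t (a : A) : H := tgt B.η a

/-- `H ⊗_{A^op} H`, the quotient of `H ⊗ H` by the relations `b ā ⊗ b' = b ⊗ ā b'`. -/
abbrev TensOp : Type u :=
  Balanced (fun a : A => AddMonoidHom.mulRight (B.t a)) (fun a : A => AddMonoidHom.mulLeft (B.t a))

/-- `(b, b') ↦ b₁ ⊗ b₂ b'`. -/
def galoisAux : H →+ H →+ Tens B.η H H :=
  AddMonoidHom.mk' (fun b => AddMonoidHom.mk'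
      (fun b' => Tens.map B.η LinearMap.id (orb H b') (B.coring.comul b))
      (fun n n' => by
        rw [← Tens.map_add_right]; congr 2; ext; simp))
    (fun b c => by ext n; simp)

theorem galoisAux_apply (b b' : H) :
    B.galoisAux b b' = Tens.map B.η LinearMap.id (orb H b') (B.coring.comul b) := rfl

/-- `β : H ⊗_{A^op} H → H ⋄ H`, `b ⊗ b' ↦ b₁ ⋄ b₂ b'`. The group `H ⋄ H`, the quotient of `H ⊗ H` by
the relations `ā b ⊗ b' = b ⊗ a b'`, is `H ⊗_A H`. -/
def galois : B.TensOp →+ Tens B.η H H :=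
  Balanced.lift B.galoisAux (fun a b c => by
    have h := B.coring.comul_mul_right b 1 a
    rw [src_one, mul_one] at h
    rw [AddMonoidHom.mulRight_apply, AddMonoidHom.coe_mulLeft, galoisAux_apply, galoisAux_apply,
      h, Tens.map_map]
    congr 2
    · ext; simp
    · ext; simp)

theorem galois_tmul (b b' : H) : B.galois (Balanced.tmul b b') = B.galoisAux b b' :=
  Balanced.lift_tmul _ _ _ _

/-- `H` is a left Hopf algebroid: the map `β` is invertible. -/
def IsLeftHopf : Prop := Function.Bijective B.galois

/-! ### The monoidal category of `H`-modules -/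

section Modules

variable {M M' N N' L : Type u} [AddCommGroup M] [Module H M] [AddCommGroup M'] [Module H M']
  [AddCommGroup N] [Module H N] [AddCommGroup N'] [Module H N'] [AddCommGroup L] [Module H L]

theorem act_map (b : H) (f : M →ₗ[H] M') (g : N →ₗ[H] N') (x : Tens B.η M N) :
    B.coring.act b (Tens.map B.η f g x) = Tens.map B.η f g (B.coring.act b x) :=
  Balanced.fun_ext (f := (B.coring.act b).comp (Tens.map B.η f g))
    (g := (Tens.map B.η f g).comp (B.coring.act b)) (fun m n => by
      change Tens.map B.η (orb H (f m)) (orb H (g n)) (B.coring.comul b) =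
        Tens.map B.η f g (Tens.map B.η (orb H m) (orb H n) (B.coring.comul b))
      rw [Tens.map_map]
      congr 2
      · ext; simp
      · ext; simp) x

/-- The `H`-action `b (m ⊗ n) = b₁ m ⊗ b₂ n` on `M ⊗_A N`. -/
instance tensModule : Module H (Tens B.η M N) where
  smul b x := B.coring.act b x
  one_smul x := Balanced.fun_ext (f := B.coring.act (1 : H)) (g := AddMonoidHom.id (Tens B.η M N))
    (fun m n => by
      change Tens.map B.η (orb H m) (orb H n) (B.coring.comul 1) = Tens.tmul B.η m n
      rw [B.comul_one, Tens.map_tmul]; simp) x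
  mul_smul b c x := Balanced.fun_ext (f := B.coring.act (b * c))
    (g := (B.coring.act b).comp (B.coring.act c))
    (fun m n => by
      change Tens.map B.η (orb H m) (orb H n) (B.coring.comul (b * c)) =
        B.coring.act b (Tens.map B.η (orb H m) (orb H n) (B.coring.comul c))
      rw [B.comul_mul, act_map]) x
  smul_zero b := map_zero (B.coring.act b)
  smul_add b := map_add (B.coring.act b)
  add_smul b c x := Balanced.fun_ext (f := B.coring.act (b + c))
    (g := B.coring.act b + B.coring.act c)
    (fun m n => by
      change Tens.map B.η (orb H m) (orb H n) (B.coring.comul (b + c)) =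
        Tens.map B.η (orb H m) (orb H n) (B.coring.comul b) +
        Tens.map B.η (orb H m) (orb H n) (B.coring.comul c)
      rw [map_add, map_add]) x
  zero_smul x := Balanced.fun_ext (f := B.coring.act (0 : H)) (g := (0 : Tens B.η M N →+ _))
    (fun m n => by
      change Tens.map B.η (orb H m) (orb H n) (B.coring.comul 0) = 0
      rw [map_zero, map_zero]) x

theorem smul_tens (b : H) (x : Tens B.η M N) : b • x = B.coring.act b x := rfl

theorem smul_tmul (b : H) (m : M) (n : N) :
    b • Tens.tmul B.η m n = Tens.map B.η (orb H m) (orb H n) (B.coring.comul b) := rfl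

theorem src_smul_tmul (a : A) (m : M) (n : N) :
    B.s a • Tens.tmul B.η m n = Tens.tmul B.η (B.s a • m) n := by
  have h := B.coring.comul_left a 1
  rw [mul_one, B.comul_one, Tens.lAct_tmul] at h
  rw [smul_tmul, h, Tens.map_tmul]
  simp

theorem tgt_smul_tmul (a : A) (m : M) (n : N) :
    B.t a • Tens.tmul B.η m n = Tens.tmul B.η m (B.t a • n) := by
  have h := B.coring.comul_right a 1
  rw [mul_one, B.comul_one, Tens.rAct_tmul] at h
  rw [smul_tmul, h, Tens.map_tmul]
  simp

/-- `f ⊗ g` as an `H`-linear map. -/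
def mapLin (f : M →ₗ[H] M') (g : N →ₗ[H] N') : Tens B.η M N →ₗ[H] Tens B.η M' N' :=
  { Tens.map B.η f g with map_smul' := fun b x => (B.act_map b f g x).symm }

@[simp] theorem mapLin_tmul (f : M →ₗ[H] M') (g : N →ₗ[H] N') (m : M) (n : N) :
    B.mapLin f g (Tens.tmul B.η m n) = Tens.tmul B.η (f m) (g n) := rfl

theorem lin_ext {f g : Tens B.η M N →ₗ[H] L}
    (h : ∀ m n, f (Tens.tmul B.η m n) = g (Tens.tmul B.η m n)) : f = g :=
  LinearMap.toAddMonoidHom_injective (Balanced.hom_ext h)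

theorem lin_ext₃ {f g : Tens B.η (Tens B.η M N) L →ₗ[H] M'}
    (h : ∀ m n l, f (Tens.tmul B.η (Tens.tmul B.η m n) l) =
      g (Tens.tmul B.η (Tens.tmul B.η m n) l)) : f = g :=
  LinearMap.toAddMonoidHom_injective (Balanced.hom_ext₃ _ h)

/-- The additive map `(m ⊗ n) ⊗ l ↦ m ⊗ (n ⊗ l)`. -/
def assocAdd : Tens B.η (Tens B.η M N) L →+ Tens B.η M (Tens B.η N L) :=
  Balanced.assocHom (ρN := rAct B.η N) (rAct B.η (Tens B.η M N)) (fun a m n => B.tgt_smul_tmul a m n)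
    (lAct B.η (Tens B.η N L)) (fun a n l => B.src_smul_tmul a n l)

theorem assocAdd_tmul (m : M) (n : N) (l : L) :
    B.assocAdd (Tens.tmul B.η (Tens.tmul B.η m n) l) =
      Tens.tmul B.η m (Tens.tmul B.η n l) := rfl

/-- `x ⊗ (y ⊗ z) ↦ x m ⊗ (y n ⊗ z l)`. -/
def orb₃ (m : M) (n : N) (l : L) : TensR B.η H H H →+ Tens B.η M (Tens B.η N L) :=
  Balanced.map (orb H m).toAddMonoidHom (fun a x => (orb H m).map_smul (tgt B.η a) x)
    (Tens.map B.η (orb H n) (orb H l)) (fun a => Balanced.fun_ext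
      (f := (Tens.map B.η (orb H n) (orb H l)).comp (Tens.lAct B.η H H a))
      (g := (lAct B.η (Tens B.η N L) a).comp (Tens.map B.η (orb H n) (orb H l)))
      (fun x y => by
        change Tens.tmul B.η ((B.s a • x) • n) (y • l) = B.s a • Tens.tmul B.η (x • n) (y • l)
        rw [src_smul_tmul, smul_assoc]))

theorem assocAdd_smul (b : H) (m : M) (n : N) (l : L) :
    B.assocAdd (b • Tens.tmul B.η (Tens.tmul B.η m n) l) =
      b • Tens.tmul B.η m (Tens.tmul B.η n l) := by
  have h := congrArg (B.orb₃ m n l) (B.coring.coassoc b)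
  have e1 : ∀ x : Tens B.η H H,
      B.orb₃ m n l (Tens.assoc B.η (comulTensor B.η B.coring.comul B.coring.comul_right x)) =
        B.assocAdd (Tens.map B.η (orb H (Tens.tmul B.η m n)) (orb H l) x) :=
    Balanced.fun_ext
      (f := (B.orb₃ m n l).comp ((Tens.assoc B.η).comp
        (comulTensor B.η B.coring.comul B.coring.comul_right)))
      (g := B.assocAdd.comp (Tens.map B.η (orb H (Tens.tmul B.η m n)) (orb H l)))
      (fun x y => Balanced.fun_ext
        (f := ((B.orb₃ m n l).comp (Tens.assoc B.η)).comp
          ((Balanced.mk₂ (Tens.rAct B.η H H) (lAct B.η H)).flip y))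
        (g := (B.assocAdd.comp ((Balanced.mk₂ (rAct B.η (Tens B.η M N)) (lAct B.η L)).flip
          (y • l))).comp (Tens.map B.η (orb H m) (orb H n)))
        (fun _ _ => rfl) (B.coring.comul x))
  have e2 : ∀ x : Tens B.η H H,
      B.orb₃ m n l (tensorComul B.η B.coring.comul B.coring.comul_left x) =
        Tens.map B.η (orb H m) (orb H (Tens.tmul B.η n l)) x :=
    Balanced.fun_ext
      (f := (B.orb₃ m n l).comp (tensorComul B.η B.coring.comul B.coring.comul_left))
      (g := Tens.map B.η (orb H m) (orb H (Tens.tmul B.η n l)))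
      (fun _ _ => rfl)
  rw [e1, e2] at h
  exact h

/-- The associativity constraint of `H`-modules. -/
def assocEquiv : Tens B.η (Tens B.η M N) L ≃ₗ[H] Tens B.η M (Tens B.η N L) where
  toFun := B.assocAdd
  map_add' := map_add _
  map_smul' b x := DFunLike.congr_fun
    (f := B.assocAdd.comp (DistribSMul.toAddMonoidHom (Tens B.η (Tens B.η M N) L) b))
    (g := (DistribSMul.toAddMonoidHom (Tens B.η M (Tens B.η N L)) b).comp B.assocAdd)
    (Balanced.hom_ext₃ _ fun m n l => B.assocAdd_smul b m n l) x
  invFun := Balanced.assocInv (ρN := rAct B.η N) (rAct B.η (Tens B.η M N)) (fun a m n => B.tgt_smul_tmul a m n)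
    (lAct B.η (Tens B.η N L)) (fun a n l => B.src_smul_tmul a n l)
  left_inv x := DFunLike.congr_fun
    (f := (Balanced.assocInv (ρN := rAct B.η N) (rAct B.η (Tens B.η M N)) (fun a m n => B.tgt_smul_tmul a m n)
      (lAct B.η (Tens B.η N L)) (fun a n l => B.src_smul_tmul a n l)).comp B.assocAdd)
    (g := AddMonoidHom.id _) (Balanced.hom_ext₃ _ fun _ _ _ => rfl) x
  right_inv x := DFunLike.congr_fun
    (f := B.assocAdd.comp (Balanced.assocInv (ρN := rAct B.η N) (rAct B.η (Tens B.η M N))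
      (fun a m n => B.tgt_smul_tmul a m n)
      (lAct B.η (Tens B.η N L)) (fun a n l => B.src_smul_tmul a n l)))
    (g := AddMonoidHom.id _) (Balanced.hom_ext₃' _ fun _ _ _ => rfl) x

@[simp] theorem assocEquiv_tmul (m : M) (n : N) (l : L) :
    B.assocEquiv (Tens.tmul B.η (Tens.tmul B.η m n) l) =
      Tens.tmul B.η m (Tens.tmul B.η n l) := rfl

/-- The base algebra `A` as an `H`-module; this is the unit object of the category of
`H`-modules. -/
def Base (_ : LeftBialgebroid k A H) : Type u := A

instance : AddCommGroup B.Base := inferInstanceAs (AddCommGroup A)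

/-- The element of the module `A` given by an element of the algebra `A`. -/
def toBase (a : A) : B.Base := a

/-- The element of the algebra `A` given by an element of the module `A`. -/
def ofBase (a : B.Base) : A := a

/-- The `H`-action `b ▷ a = ε(b a)` on `A`. -/
instance baseModule : Module H B.Base where
  smul b a := B.toBase (B.coring.counit (b * B.s (B.ofBase a)))
  one_smul a := by
    change B.coring.counit (1 * B.s (B.ofBase a)) = B.ofBase a
    have h := B.coring.counit_left (B.ofBase a) 1
    rw [mul_one, B.counit_one, mul_one] at h
    rw [one_mul, h]
  mul_smul b c a := by
    change B.coring.counit (b * c * B.s (B.ofBase a)) =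
      B.coring.counit (b * B.s (B.coring.counit (c * B.s (B.ofBase a))))
    rw [mul_assoc, B.counit_mul_src]
  smul_zero b := by
    change B.coring.counit (b * B.s 0) = 0
    simp [s, src]
  smul_add b a c := by
    change B.coring.counit (b * B.s (B.ofBase a + B.ofBase c)) =
      B.coring.counit (b * B.s (B.ofBase a)) + B.coring.counit (b * B.s (B.ofBase c))
    rw [s, src_add, mul_add, map_add]
  add_smul b c a := by
    change B.coring.counit ((b + c) * B.s (B.ofBase a)) =
      B.coring.counit (b * B.s (B.ofBase a)) + B.coring.counit (c * B.s (B.ofBase a))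
    rw [add_mul, map_add]
  zero_smul a := by
    change B.coring.counit (0 * B.s (B.ofBase a)) = 0
    rw [zero_mul, map_zero]

theorem smul_base (b : H) (a : B.Base) :
    B.ofBase (b • a) = B.coring.counit (b * B.s (B.ofBase a)) := rfl

theorem src_smul_base (r : A) (a : B.Base) : B.ofBase (B.s r • a) = r * B.ofBase a := by
  have h := B.coring.counit_left (r * B.ofBase a) 1
  rw [mul_one, B.counit_one, mul_one, src_mul] at h
  exact h

theorem tgt_smul_base (r : A) (a : B.Base) : B.ofBase (B.t r • a) = B.ofBase a * r := by
  have h := B.coring.counit_right r (B.s (B.ofBase a))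
  have h' := B.coring.counit_left (B.ofBase a) 1
  rw [mul_one, B.counit_one, mul_one] at h'
  rw [h'] at h
  exact h

/-- The additive map `a ⊗ m ↦ a m`. -/
def leftUnitorAdd : Tens B.η B.Base M →+ M :=
  Balanced.lift
    (AddMonoidHom.mk' (fun a => DistribSMul.toAddMonoidHom M (B.s (B.ofBase a)))
      (fun a b => by
        ext m
        change B.s (B.ofBase a + B.ofBase b) • m = B.s (B.ofBase a) • m + B.s (B.ofBase b) • m
        rw [s, src_add, add_smul]))
    (fun r a m => by
      change B.s (B.ofBase (B.t r • a)) • m = B.s (B.ofBase a) • B.s r • m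
      rw [tgt_smul_base, s, src_mul, mul_smul])

theorem leftUnitorAdd_tmul (a : B.Base) (m : M) :
    B.leftUnitorAdd (Tens.tmul B.η a m) = B.s (B.ofBase a) • m := rfl

/-- The additive map `m ⊗ a ↦ m a`. -/
def rightUnitorAdd : Tens B.η M B.Base →+ M :=
  Balanced.lift
    (AddMonoidHom.mk' (fun m => AddMonoidHom.mk' (fun a => B.t (B.ofBase a) • m)
        (fun a b => by
          change B.t (B.ofBase a + B.ofBase b) • m = B.t (B.ofBase a) • m + B.t (B.ofBase b) • m
          rw [t, tgt_add, add_smul]))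
      (fun m n => by ext a; exact smul_add _ _ _))
    (fun r m a => by
      change B.t (B.ofBase a) • B.t r • m = B.t (B.ofBase (B.s r • a)) • m
      rw [src_smul_base, t, t, t, tgt_mul, mul_smul])

theorem rightUnitorAdd_tmul (m : M) (a : B.Base) :
    B.rightUnitorAdd (Tens.tmul B.η m a) = B.t (B.ofBase a) • m := rfl

theorem leftUnitorAdd_smul (b : H) (a : B.Base) (m : M) :
    B.leftUnitorAdd (b • Tens.tmul B.η a m) = b • B.s (B.ofBase a) • m := by
  have h := B.coring.counit_comul (b * B.s (B.ofBase a) * B.t 1)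
  rw [B.coring.comul_mul_right, t, tgt_one, mul_one] at h
  have e : ∀ x : Tens B.η H H, B.leftUnitorAdd (Tens.map B.η (orb H a) (orb H m) x) =
      counitLeft B.η B.coring.counit B.coring.counit_right
        (Tens.map B.η (orb H (B.s (B.ofBase a))) (orb H 1) x) • m :=
    Balanced.fun_ext (f := B.leftUnitorAdd.comp (Tens.map B.η (orb H a) (orb H m)))
      (g := (orb H m).toAddMonoidHom.comp ((counitLeft B.η B.coring.counit
        B.coring.counit_right).comp (Tens.map B.η (orb H (B.s (B.ofBase a))) (orb H 1))))
      (fun x y => by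
        change B.s (B.coring.counit (x * B.s (B.ofBase a))) • y • m =
          (B.s (B.coring.counit (x * B.s (B.ofBase a))) * (y * 1)) • m
        rw [mul_one, mul_smul])
  rw [smul_tmul, e, h, mul_smul]

theorem rightUnitorAdd_smul (b : H) (m : M) (a : B.Base) :
    B.rightUnitorAdd (b • Tens.tmul B.η m a) = b • B.t (B.ofBase a) • m := by
  have h := B.coring.comul_counit (b * B.s 1 * B.t (B.ofBase a))
  rw [B.coring.comul_mul_right, s, src_one, mul_one] at h
  have e : ∀ x : Tens B.η H H, B.rightUnitorAdd (Tens.map B.η (orb H m) (orb H a) x) =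
      counitRight B.η B.coring.counit B.coring.counit_left
        (Tens.map B.η (orb H 1) (orb H (B.t (B.ofBase a))) x) • m :=
    Balanced.fun_ext (f := B.rightUnitorAdd.comp (Tens.map B.η (orb H m) (orb H a)))
      (g := (orb H m).toAddMonoidHom.comp ((counitRight B.η B.coring.counit
        B.coring.counit_left).comp (Tens.map B.η (orb H 1) (orb H (B.t (B.ofBase a))))))
      (fun x y => by
        change B.t (B.coring.counit (y * B.s (B.ofBase a))) • x • m =
          (B.t (B.coring.counit (y * B.t (B.ofBase a))) * (x * 1)) • m
        rw [mul_one, mul_smul, B.coring.counit_mul_right])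
  rw [smul_tmul, e, h, mul_smul]

/-- The left unit constraint of `H`-modules. -/
def leftUnitorEquiv : Tens B.η B.Base M ≃ₗ[H] M where
  toFun := B.leftUnitorAdd
  map_add' := map_add _
  map_smul' b x := Balanced.fun_ext
    (f := B.leftUnitorAdd.comp (DistribSMul.toAddMonoidHom (Tens B.η B.Base M) b))
    (g := (DistribSMul.toAddMonoidHom M b).comp B.leftUnitorAdd)
    (fun a m => B.leftUnitorAdd_smul b a m) x
  invFun m := Tens.tmul B.η (B.toBase 1) m
  left_inv x := Balanced.fun_ext
    (f := (Balanced.mk₂ (rAct B.η B.Base) (lAct B.η M) (B.toBase 1)).comp B.leftUnitorAdd)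
    (g := AddMonoidHom.id _)
    (fun a m => by
      change Tens.tmul B.η (B.toBase 1) (B.s (B.ofBase a) • m) = Tens.tmul B.η a m
      rw [← Tens.balance]
      congr 1
      exact (B.tgt_smul_base (B.ofBase a) (B.toBase 1)).trans (one_mul _)) x
  right_inv m := by
    change B.s 1 • m = m
    rw [s, src_one, one_smul]

/-- The right unit constraint of `H`-modules. -/
def rightUnitorEquiv : Tens B.η M B.Base ≃ₗ[H] M where
  toFun := B.rightUnitorAdd
  map_add' := map_add _
  map_smul' b x := Balanced.fun_ext
    (f := B.rightUnitorAdd.comp (DistribSMul.toAddMonoidHom (Tens B.η M B.Base) b))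
    (g := (DistribSMul.toAddMonoidHom M b).comp B.rightUnitorAdd)
    (fun m a => B.rightUnitorAdd_smul b m a) x
  invFun m := Tens.tmul B.η m (B.toBase 1)
  left_inv x := Balanced.fun_ext
    (f := ((Balanced.mk₂ (rAct B.η M) (lAct B.η B.Base)).flip (B.toBase 1)).comp B.rightUnitorAdd)
    (g := AddMonoidHom.id _)
    (fun m a => by
      change Tens.tmul B.η (B.t (B.ofBase a) • m) (B.toBase 1) = Tens.tmul B.η m a
      rw [Tens.balance]
      congr 1
      exact (B.src_smul_base (B.ofBase a) (B.toBase 1)).trans (mul_one _)) x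
  right_inv m := by
    change B.t 1 • m = m
    rw [t, tgt_one, one_smul]

theorem leftUnitorEquiv_tmul (a : B.Base) (m : M) :
    B.leftUnitorEquiv (Tens.tmul B.η a m) = B.s (B.ofBase a) • m := rfl

theorem rightUnitorEquiv_tmul (m : M) (a : B.Base) :
    B.rightUnitorEquiv (Tens.tmul B.η m a) = B.t (B.ofBase a) • m := rfl

end Modules

/-- The category of left `H`-modules, with the monoidal structure given by `⊗_A`. -/
def Rep (_ : LeftBialgebroid k A H) : Type (u + 1) := ModuleCat.{u} H

instance : Category.{u} B.Rep := inferInstanceAs (Category.{u} (ModuleCat.{u} H))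

instance : CoeSort B.Rep (Type u) := ⟨fun M => ModuleCat.carrier (R := H) M⟩

instance (M : B.Rep) : AddCommGroup M := ModuleCat.isAddCommGroup (R := H) M

instance (M : B.Rep) : Module H M := ModuleCat.isModule (R := H) M

/-- An `H`-module as an object of the category of `H`-modules. -/
def of (M : Type u) [AddCommGroup M] [Module H M] : B.Rep := ModuleCat.of H M

variable {B} in
/-- The `H`-linear map underlying a morphism. -/
def lin {M N : B.Rep} (f : M ⟶ N) : M →ₗ[H] N := ModuleCat.Hom.hom (R := H) f

/-- The morphism given by an `H`-linear map. -/
def mor {M N : B.Rep} (f : M →ₗ[H] N) : M ⟶ N := ModuleCat.ofHom (R := H) (X := M) (Y := N) f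

variable {B} in
@[simp] theorem lin_mor {M N : B.Rep} (f : M →ₗ[H] N) : lin (B.mor f) = f := rfl

variable {B} in
@[simp] theorem lin_id (M : B.Rep) : lin (𝟙 M) = LinearMap.id := rfl

variable {B} in
@[simp] theorem lin_comp {M N L : B.Rep} (f : M ⟶ N) (g : N ⟶ L) :
    lin (f ≫ g) = (lin g).comp (lin f) := rfl

variable {B} in
theorem rep_ext {M N : B.Rep} {f g : M ⟶ N} (h : lin f = lin g) : f = g :=
  ModuleCat.hom_ext (R := H) h

/-- An isomorphism of `H`-modules as an isomorphism in the category of `H`-modules. -/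
def isoOf {M N : B.Rep} (e : M ≃ₗ[H] N) : M ≅ N where
  hom := B.mor e.toLinearMap
  inv := B.mor e.symm.toLinearMap
  hom_inv_id := rep_ext (by ext x; simp)
  inv_hom_id := rep_ext (by ext x; simp)

instance : MonoidalCategoryStruct B.Rep where
  tensorObj M N := B.of (Tens B.η M N)
  whiskerLeft M _ _ f := B.mor (B.mapLin (LinearMap.id : M →ₗ[H] M) (lin f))
  whiskerRight f N := B.mor (B.mapLin (lin f) (LinearMap.id : N →ₗ[H] N))
  tensorHom f g := B.mor (B.mapLin (lin f) (lin g))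
  tensorUnit := B.of B.Base
  associator M N L := B.isoOf (B.assocEquiv (M := M) (N := N) (L := L))
  leftUnitor M := B.isoOf (B.leftUnitorEquiv (M := M))
  rightUnitor M := B.isoOf (B.rightUnitorEquiv (M := M))

/-- The monoidal category of `H`-modules, with `b (m ⊗ n) = b₁ m ⊗ b₂ n`. -/
instance : MonoidalCategory B.Rep :=
  MonoidalCategory.ofTensorHom
    (id_tensorHom_id := fun _ _ => rep_ext (B.lin_ext fun _ _ => rfl))
    (id_tensorHom := fun _ _ _ _ => rfl)
    (tensorHom_id := fun _ _ => rfl)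
    (tensorHom_comp_tensorHom := fun _ _ _ _ => rep_ext (B.lin_ext fun _ _ => rfl))
    (associator_naturality := fun _ _ _ => rep_ext (B.lin_ext₃ fun _ _ _ => rfl))
    (leftUnitor_naturality := fun f => rep_ext (B.lin_ext fun a m =>
      ((lin f).map_smul (B.s (B.ofBase a)) m).symm))
    (rightUnitor_naturality := fun f => rep_ext (B.lin_ext fun m a =>
      ((lin f).map_smul (B.t (B.ofBase a)) m).symm))
    (pentagon := fun W X Y Z => rep_ext (LinearMap.toAddMonoidHom_injective
      (Balanced.hom_ext fun x z => Balanced.fun_ext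
        (f := (lin (tensorHom (associator W X Y).hom (𝟙 Z) ≫
            (associator W (tensorObj X Y) Z).hom ≫
              tensorHom (𝟙 W) (associator X Y Z).hom)).toAddMonoidHom.comp
          ((Balanced.mk₂ (rAct B.η (Tens B.η (Tens B.η W X) Y)) (lAct B.η Z)).flip z))
        (g := (lin ((associator (tensorObj W X) Y Z).hom ≫
            (associator W X (tensorObj Y Z)).hom)).toAddMonoidHom.comp
          ((Balanced.mk₂ (rAct B.η (Tens B.η (Tens B.η W X) Y)) (lAct B.η Z)).flip z))
        (fun x' y => Balanced.fun_ext
          (f := ((lin (tensorHom (associator W X Y).hom (𝟙 Z) ≫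
              (associator W (tensorObj X Y) Z).hom ≫
                tensorHom (𝟙 W) (associator X Y Z).hom)).toAddMonoidHom.comp
            ((Balanced.mk₂ (rAct B.η (Tens B.η (Tens B.η W X) Y)) (lAct B.η Z)).flip z)).comp
            ((Balanced.mk₂ (rAct B.η (Tens B.η W X)) (lAct B.η Y)).flip y))
          (g := ((lin ((associator (tensorObj W X) Y Z).hom ≫
              (associator W X (tensorObj Y Z)).hom)).toAddMonoidHom.comp
            ((Balanced.mk₂ (rAct B.η (Tens B.η (Tens B.η W X) Y)) (lAct B.η Z)).flip z)).comp
            ((Balanced.mk₂ (rAct B.η (Tens B.η W X)) (lAct B.η Y)).flip y))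
          (fun _ _ => rfl) x') x)))
    (triangle := fun _ _ => rep_ext (B.lin_ext₃ fun m a n =>
      (Tens.balance B.η (B.ofBase a) m n).symm))

/-- `m ⊗ n` as an element of the tensor product in the category of `H`-modules. -/
def tmul {M N : B.Rep} (m : M) (n : N) : (M ⊗ N : B.Rep) := Tens.tmul B.η m n

/-- `f ⊗ g` on `H ⊗_A H`, with values in the tensor product of the category of `H`-modules. -/
def onTens {M N : B.Rep} (f : H →ₗ[H] M) (g : H →ₗ[H] N) : Tens B.η H H →+ (M ⊗ N : B.Rep) :=
  Tens.map B.η f g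

/-! ### The induced coalgebra `H ⊠ A` -/

/-- `H ⊠ A = H ⊗_{A^e} A`, the quotient of `H ⊗ A` by the relations
`(b r s̄) ⊗ a = b ⊗ (r a s)`. -/
def Box : Type u :=
  Balanced (fun r : A × A => AddMonoidHom.mulRight (B.s r.1 * B.t r.2))
    (fun r : A × A => (AddMonoidHom.mulLeft r.1).comp (AddMonoidHom.mulRight r.2))

instance : AddCommGroup B.Box := inferInstanceAs (AddCommGroup (Balanced _ _))

/-- The element `h ⊠ a`. -/
def boxTmul (h : H) (a : A) : B.Box := Balanced.tmul h a

/-- The map `h' ⊠ a ↦ (h h') ⊠ a`. -/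
def boxAct (h : H) : B.Box →+ B.Box :=
  Balanced.map (AddMonoidHom.mulLeft h)
    (fun r b => by simp [mul_assoc])
    (AddMonoidHom.id A) (fun _ _ => rfl)

instance boxModule : Module H B.Box where
  smul h x := B.boxAct h x
  one_smul x := Balanced.fun_ext (f := B.boxAct 1) (g := AddMonoidHom.id _)
    (fun b a => congrArg (B.boxTmul · a) (one_mul b)) x
  mul_smul h h' x := Balanced.fun_ext (f := B.boxAct (h * h'))
    (g := (B.boxAct h).comp (B.boxAct h'))
    (fun b a => congrArg (B.boxTmul · a) (mul_assoc h h' b)) x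
  smul_zero h := map_zero (B.boxAct h)
  smul_add h := map_add (B.boxAct h)
  add_smul h h' x := Balanced.fun_ext (f := B.boxAct (h + h')) (g := B.boxAct h + B.boxAct h')
    (fun b a => (congrArg (B.boxTmul · a) (add_mul h h' b)).trans (Balanced.add_tmul _ _ _)) x
  zero_smul x := Balanced.fun_ext (f := B.boxAct 0) (g := 0)
    (fun b a => (congrArg (B.boxTmul · a) (zero_mul b)).trans
      (map_zero ((Balanced.mk₂ _ _).flip a))) x

theorem smul_boxTmul (h h' : H) (a : A) : h • B.boxTmul h' a = B.boxTmul (h * h') a := rfl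

/-- `H ⊠ A` as an object of the category of `H`-modules. -/
def induced : B.Rep := B.of B.Box

/-- The element `h ⊠ a` of the object `H ⊠ A`. -/
def box (h : H) (a : A) : B.induced := B.boxTmul h a

/-- The left ideal of `H` generated by the elements `a - ā`. -/
def leftIdeal : Submodule H H := Submodule.span H (Set.range fun a : A => B.s a - B.t a)

end LeftBialgebroid

/-! ### Lax braidings and lax central coalgebras -/

section Lax

universe v₁ u₁

variable {D : Type u₁} [Category.{v₁} D] [MonoidalCategory D]

/-- A lax braiding `τ : X ⊗ - → - ⊗ X`; the pair `(X, τ)` is an object of the lax left center. -/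
structure LaxBraiding (X : D) where
  /-- The components of the lax braiding. -/
  τ : ∀ Y : D, X ⊗ Y ⟶ Y ⊗ X
  /-- `τ` is natural. -/
  naturality : ∀ {Y Z : D} (f : Y ⟶ Z), X ◁ f ≫ τ Z = τ Y ≫ f ▷ X
  /-- `τ_{Y ⊗ Z} = (Y ⊗ τ_Z) (τ_Y ⊗ Z)`. -/
  tensor : ∀ Y Z : D, τ (Y ⊗ Z) =
    (α_ X Y Z).inv ≫ τ Y ▷ Z ≫ (α_ Y X Z).hom ≫ Y ◁ τ Z ≫ (α_ Y Z X).inv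
  /-- `τ` is trivial at the unit object. -/
  unit : τ (𝟙_ D) = (ρ_ X).hom ≫ (λ_ X).inv

/-- A coalgebra `C` with a lax braiding `τ` is a lax central coalgebra, and it is cocommutative. -/
structure LaxBraiding.IsLaxCCC {C : D} [ComonObj C] (σ : LaxBraiding C) : Prop where
  /-- `(τ ⊗ C) (C ⊗ τ) (Δ ⊗ Y) = (Y ⊗ Δ) τ`. -/
  comul : ∀ Y : D, (ComonObj.comul : C ⟶ C ⊗ C) ▷ Y ≫ (α_ C C Y).hom ≫ C ◁ σ.τ Y ≫
    (α_ C Y C).inv ≫ σ.τ Y ▷ C ≫ (α_ Y C C).hom = σ.τ Y ≫ Y ◁ (ComonObj.comul : C ⟶ C ⊗ C)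
  /-- `(Y ⊗ ε) τ = ε ⊗ Y`. -/
  counit : ∀ Y : D, σ.τ Y ≫ Y ◁ (ComonObj.counit : C ⟶ 𝟙_ D) ≫ (ρ_ Y).hom =
    (ComonObj.counit : C ⟶ 𝟙_ D) ▷ Y ≫ (λ_ Y).hom
  /-- `τ_C Δ = Δ`. -/
  cocomm : (ComonObj.comul : C ⟶ C ⊗ C) ≫ σ.τ C = ComonObj.comul

end Lax

end HopfAlgebroid

end

/-!
Write `C = H ⊠ A` and `u = 1 ⊠ 1`. Since `h ⊠ a = (h a) u` and `a u = ā u`, the `H`-module `C` is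
cyclic on `u`, and an `H`-linear map out of `C` is the same thing as an element `m` (the image of
`u`) with `a m = ā m` for all `a`. Taking `m` to be the class of `1` in the quotient of `H` by the
left ideal generated by the `a - ā`, the element `u ⊗ u`, or the unit of `A`, gives the first
isomorphism, the comultiplication and the counit; the coalgebra axioms hold because they hold at
`u` (`induced_hom_ext`).

If `β` is surjective, then `h ⊗ 1` is a sum of elements `b₁ ⊗ b₂ b'`, hence `h u ⊗ m` is a sum of
elements `b (u ⊗ b' m)`, and the elements `u ⊗ m` generate the `H`-module `C ⊗ M`
(`induced_tensor_hom_ext`). The braiding `τ` sends `u ⊗ m` to `m ⊗ u`, and this determines it: all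
the identities required of `τ` are checked on the elements `u ⊗ m`, where they are immediate.

What remains is the existence of `τ`. For `x = ∑ b ⊗ b'` in `H ⊗_{A^op} H` set
`Θ x m = ∑ b (b' m ⊗ u)` (`laxBraidPre`). The assignment `h u ⊗ m ↦ Θ (β⁻¹(h ⊗ 1)) m` respects the
relation `h a u = h ā u`: under `β`, right multiplication of the first tensor factor by `a`
corresponds to `b ⊗ b' ↦ b a ⊗ b'`, and, by the Takeuchi condition `b₁ ā ⊗ b₂ = b₁ ⊗ b₂ a`, right
multiplication by `ā` corresponds to `b ⊗ b' ↦ b ⊗ a b'`; these two maps become equal after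
applying `Θ`. The resulting map is `H`-linear since it sends `b (u ⊗ m)` to `b (m ⊗ u)`
(`laxBraidAdd_smul_unit_tmul`).
-/

noncomputable section

namespace HopfAlgebroid

namespace LeftBialgebroid

variable {k : Type v} {A H : Type u} [CommRing k] [Ring A] [Algebra k A] [Ring H] [Algebra k H]
  (B : LeftBialgebroid k A H)

/-! ### Maps out of `H ⊠ A` -/

theorem boxTmul_mul (b : H) (r s a : A) :
    B.boxTmul (b * (B.s r * B.t s)) a = B.boxTmul b (r * (a * s)) :=
  Balanced.balance (r, s) b a

theorem boxTmul_eq_smul (h : H) (a : A) : B.boxTmul h a = (h * B.s a) • B.boxTmul 1 1 := by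
  have e := B.boxTmul_mul h a 1 1
  rw [t, tgt_one, mul_one, mul_one, mul_one] at e
  rw [smul_boxTmul, mul_one, e]

theorem src_smul_box (a : A) : B.s a • B.boxTmul 1 1 = B.boxTmul 1 a := by
  rw [boxTmul_eq_smul B 1 a, one_mul]

theorem mul_src_tgt_src (h : H) (r s a : A) :
    h * (B.s r * B.t s) * B.s a = h * B.s r * B.s a * B.t s := by
  rw [mul_assoc, mul_assoc, ← src_tgt_comm, ← mul_assoc, ← mul_assoc, mul_assoc, mul_assoc]

theorem mul_src_src_src (h : H) (r a s : A) :
    h * B.s r * B.s a * B.s s = h * B.s (r * (a * s)) := by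
  simp only [LeftBialgebroid.s, src_mul, mul_assoc]

theorem tgt_smul_box (a : A) : B.t a • B.boxTmul 1 1 = B.boxTmul 1 a := by
  have e := B.boxTmul_mul 1 1 a 1
  rw [s, src_one, one_mul, one_mul, one_mul, one_mul] at e
  rw [smul_boxTmul, mul_one, e]

theorem src_smul_box_one (a : A) : B.s a • B.boxTmul 1 1 = B.t a • B.boxTmul 1 1 :=
  (B.src_smul_box a).trans (B.tgt_smul_box a).symm

section Lift

variable {M : Type u} [AddCommGroup M] [Module H M]

/-- The additive map `h ⊠ a ↦ (h a) m` given by an element `m` with `a m = ā m` for all `a`. -/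
def boxLiftAdd (m : M) (hm : ∀ a, B.s a • m = B.t a • m) : B.Box →+ M :=
  Balanced.lift
    (AddMonoidHom.mk' (fun h => AddMonoidHom.mk' (fun a => (h * B.s a) • m)
        (fun a b => by rw [s, src_add, mul_add, add_smul]))
      (fun h h' => by
        ext a
        change ((h + h') * B.s a) • m = (h * B.s a) • m + (h' * B.s a) • m
        rw [add_mul, add_smul]))
    (fun r h a => by
      change (h * (B.s r.1 * B.t r.2) * B.s a) • m = (h * B.s (r.1 * (a * r.2))) • m
      rw [mul_src_tgt_src, mul_smul, ← hm, ← mul_smul, mul_src_src_src])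

/-- The map of `boxLiftAdd`, as an `H`-linear map. -/
def boxLift (m : M) (hm : ∀ a, B.s a • m = B.t a • m) : B.Box →ₗ[H] M where
  toFun := B.boxLiftAdd m hm
  map_add' := map_add _
  map_smul' b := Balanced.fun_ext
    (f := (B.boxLiftAdd m hm).comp (DistribSMul.toAddMonoidHom B.Box b))
    (g := (DistribSMul.toAddMonoidHom M b).comp (B.boxLiftAdd m hm))
    (fun h a => by
      change (b * h * B.s a) • m = b • (h * B.s a) • m
      rw [mul_assoc, mul_smul])

theorem boxLift_boxTmul (m : M) (hm : ∀ a, B.s a • m = B.t a • m) (h : H) (a : A) :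
    B.boxLift m hm (B.boxTmul h a) = (h * B.s a) • m := rfl

variable {B} in
theorem box_lin_ext {f g : B.Box →ₗ[H] M} (h : f (B.boxTmul 1 1) = g (B.boxTmul 1 1)) : f = g :=
  LinearMap.toAddMonoidHom_injective (Balanced.hom_ext fun b a => by
    change f (B.boxTmul b a) = g (B.boxTmul b a)
    rw [boxTmul_eq_smul, map_smul, map_smul, h])

theorem boxLift_box_one (m : M) (hm : ∀ a, B.s a • m = B.t a • m) :
    B.boxLift m hm (B.boxTmul 1 1) = m := by
  rw [boxLift_boxTmul, s, src_one, one_mul, one_smul]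

end Lift

theorem mk_src_eq_mk_tgt (a : A) :
    B.s a • B.leftIdeal.mkQ 1 = B.t a • B.leftIdeal.mkQ 1 := by
  rw [← map_smul, ← map_smul, smul_eq_mul, smul_eq_mul, mul_one, mul_one]
  exact (Submodule.Quotient.eq _).2 (Submodule.subset_span ⟨a, rfl⟩)

/-- The map `[h] ↦ h ⊠ 1` on the quotient of `H` by the left ideal generated by the `a - ā`. -/
def quotientToBox : H ⧸ B.leftIdeal →ₗ[H] B.Box :=
  B.leftIdeal.liftQ (orb H (B.boxTmul 1 1)) (by
    refine Submodule.span_le.2 ?_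
    rintro _ ⟨a, rfl⟩
    change (B.s a - B.t a) • B.boxTmul 1 1 = 0
    rw [sub_smul, src_smul_box_one, sub_self])

theorem quotientToBox_mk (h : H) :
    B.quotientToBox (B.leftIdeal.mkQ h) = h • B.boxTmul 1 1 := rfl

/-- `H ⊠ A` is the quotient of `H` by the left ideal generated by the elements `a - ā`. -/
def boxEquiv : B.Box ≃ₗ[H] H ⧸ B.leftIdeal :=
  LinearEquiv.ofLinearMap (B.boxLift (B.leftIdeal.mkQ 1) B.mk_src_eq_mk_tgt)
    B.quotientToBox
    (Submodule.linearMap_qext _ (LinearMap.ext_ring (by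
      change B.boxLift _ B.mk_src_eq_mk_tgt (B.quotientToBox (B.leftIdeal.mkQ 1)) =
        B.leftIdeal.mkQ 1
      rw [quotientToBox_mk, one_smul, boxLift_box_one])))
    (box_lin_ext (by
      change B.quotientToBox (B.boxLift _ B.mk_src_eq_mk_tgt (B.boxTmul 1 1)) = B.boxTmul 1 1
      rw [boxLift_box_one, quotientToBox_mk, one_smul]))

theorem boxEquiv_boxTmul (h : H) (a : A) :
    B.boxEquiv (B.boxTmul h a) = B.leftIdeal.mkQ (h * B.s a) := by
  change (h * B.s a) • B.leftIdeal.mkQ 1 = _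
  rw [← map_smul, smul_eq_mul, mul_one]

/-! ### The coalgebra structure -/

section Elements

variable {B}

theorem lin_comp_apply {M N L : B.Rep} (f : M ⟶ N) (g : N ⟶ L) (m : M) :
    lin (f ≫ g) m = lin g (lin f m) := rfl

theorem lin_whiskerLeft_tmul (M : B.Rep) {N L : B.Rep} (f : N ⟶ L) (m : M) (n : N) :
    lin (M ◁ f) (B.tmul m n) = B.tmul m (lin f n) := rfl

theorem lin_whiskerRight_tmul {M N : B.Rep} (f : M ⟶ N) (L : B.Rep) (m : M) (l : L) :
    lin (f ▷ L) (B.tmul m l) = B.tmul (lin f m) l := rfl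

theorem lin_associator_hom_tmul (M N L : B.Rep) (m : M) (n : N) (l : L) :
    lin (α_ M N L).hom (B.tmul (B.tmul m n) l) = B.tmul m (B.tmul n l) := rfl

theorem lin_associator_inv_tmul (M N L : B.Rep) (m : M) (n : N) (l : L) :
    lin (α_ M N L).inv (B.tmul m (B.tmul n l)) = B.tmul (B.tmul m n) l := rfl

theorem lin_leftUnitor_hom_tmul (M : B.Rep) (a : A) (m : M) :
    lin (λ_ M).hom (B.tmul (M := 𝟙_ B.Rep) (B.toBase a) m) = B.s a • m := rfl

theorem lin_rightUnitor_hom_tmul (M : B.Rep) (m : M) (a : A) :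
    lin (ρ_ M).hom (B.tmul (N := 𝟙_ B.Rep) m (B.toBase a)) = B.t a • m := rfl

theorem lin_leftUnitor_inv (M : B.Rep) (m : M) :
    lin (λ_ M).inv m = B.tmul (M := 𝟙_ B.Rep) (B.toBase 1) m := rfl

theorem lin_rightUnitor_inv (M : B.Rep) (m : M) :
    lin (ρ_ M).inv m = B.tmul (N := 𝟙_ B.Rep) m (B.toBase 1) := rfl

end Elements

/-- Morphisms out of `H ⊠ A` are determined by their value at the generator `1 ⊠ 1`. -/
theorem induced_hom_ext {M : B.Rep} {f g : B.induced ⟶ M}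
    (h : lin f (B.box 1 1) = lin g (B.box 1 1)) : f = g :=
  rep_ext (box_lin_ext h)

theorem src_smul_tmul_box (a : A) :
    B.s a • Tens.tmul B.η (B.boxTmul 1 1) (B.boxTmul 1 1) =
      B.t a • Tens.tmul B.η (B.boxTmul 1 1) (B.boxTmul 1 1) := by
  rw [src_smul_tmul, src_smul_box_one, Tens.balance, src_smul_box_one, tgt_smul_tmul]

theorem src_smul_toBase_one (a : A) : B.s a • B.toBase 1 = B.t a • B.toBase 1 :=
  ((B.src_smul_base a (B.toBase 1)).trans (mul_one a)).trans
    ((B.tgt_smul_base a (B.toBase 1)).trans (one_mul a)).symm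

/-- The comultiplication of `H ⊠ A`, determined by `Δ(1 ⊠ 1) = (1 ⊠ 1) ⊗ (1 ⊠ 1)`. -/
def inducedComul : B.induced ⟶ B.induced ⊗ B.induced :=
  B.mor (N := B.induced ⊗ B.induced) (B.boxLift (Tens.tmul B.η (B.boxTmul 1 1) (B.boxTmul 1 1))
    B.src_smul_tmul_box)

/-- The counit of `H ⊠ A`, determined by `ε(1 ⊠ 1) = 1`. -/
def inducedCounit : B.induced ⟶ 𝟙_ B.Rep :=
  B.mor (N := 𝟙_ B.Rep) (B.boxLift (B.toBase 1) B.src_smul_toBase_one)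

theorem lin_inducedComul_box_one :
    lin B.inducedComul (B.box 1 1) = B.tmul (B.box 1 1) (B.box 1 1) :=
  B.boxLift_box_one _ B.src_smul_tmul_box

theorem lin_inducedCounit_box_one :
    lin B.inducedCounit (B.box 1 1) = B.toBase 1 :=
  B.boxLift_box_one _ B.src_smul_toBase_one

/-- The coalgebra `H ⊠ A` in the category of `H`-modules. -/
@[reducible] def inducedComon : ComonObj B.induced where
  counit := B.inducedCounit
  comul := B.inducedComul
  counit_comul := B.induced_hom_ext (by
    rw [lin_comp_apply, lin_inducedComul_box_one, lin_whiskerRight_tmul,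
      lin_inducedCounit_box_one, lin_leftUnitor_inv])
  comul_counit := B.induced_hom_ext (by
    rw [lin_comp_apply, lin_inducedComul_box_one, lin_whiskerLeft_tmul,
      lin_inducedCounit_box_one, lin_rightUnitor_inv])
  comul_assoc := B.induced_hom_ext (by
    rw [lin_comp_apply, lin_comp_apply, lin_comp_apply, lin_inducedComul_box_one,
      lin_whiskerLeft_tmul, lin_whiskerRight_tmul, lin_inducedComul_box_one,
      lin_associator_hom_tmul])

theorem lin_inducedCounit_box (h : H) (a : A) :
    lin B.inducedCounit (B.box h a) = B.toBase (B.coring.counit (h * B.s a)) := by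
  change B.toBase (B.coring.counit (h * B.s a * B.s 1)) = _
  rw [s, s, src_one, mul_one]

theorem lin_inducedComul_box (h : H) (a : A) :
    lin B.inducedComul (B.box h a) =
      B.onTens (orb H (B.box 1 a)) (orb H (B.box 1 1)) (B.coring.comul h) := by
  change (h * B.s a) • Tens.tmul B.η (B.boxTmul 1 1) (B.boxTmul 1 1) = _
  rw [mul_smul, src_smul_tmul, src_smul_box]
  rfl

/-! ### The inverse of the Galois map -/

/-- `b ⊗ b' ↦ b a ⊗ b'`. -/
def opMulSrc (a : A) : B.TensOp →+ B.TensOp :=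
  Balanced.map (AddMonoidHom.mulRight (B.s a))
    (fun r b => by
      simp only [AddMonoidHom.mulRight_apply, mul_assoc, s, t, src_tgt_comm])
    (AddMonoidHom.id H) (fun _ _ => rfl)

/-- `b ⊗ b' ↦ b ⊗ a b'`. -/
def opSrcMul (a : A) : B.TensOp →+ B.TensOp :=
  Balanced.map (AddMonoidHom.id H) (fun _ _ => rfl) (AddMonoidHom.mulLeft (B.s a))
    (fun r b => by
      simp only [AddMonoidHom.coe_mulLeft, ← mul_assoc, s, t, src_tgt_comm])

theorem opSrcMul_tmul (a : A) (b b' : H) :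
    B.opSrcMul a (Balanced.tmul b b') = Balanced.tmul b (B.s a * b') := rfl

/-- `b ⊗ b' ↦ b ⊗ b' c`. -/
def opMulRight (c : H) : B.TensOp →+ B.TensOp :=
  Balanced.map (AddMonoidHom.id H) (fun _ _ => rfl) (AddMonoidHom.mulRight c)
    (fun r b => by simp [mul_assoc])

theorem galois_tmul_eq (b b' : H) :
    B.galois (Balanced.tmul b b') = Tens.map B.η LinearMap.id (orb H b') (B.coring.comul b) :=
  B.galois_tmul b b'

theorem comul_mul_src (b : H) (a : A) :
    B.coring.comul (b * B.s a) =
      Tens.map B.η (orb H (B.s a)) LinearMap.id (B.coring.comul b) := by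
  have h := B.coring.comul_mul_right b a 1
  rw [tgt_one, mul_one] at h
  rw [h]
  congr 2
  ext; simp

theorem galois_opMulSrc (a : A) (x : B.TensOp) :
    B.galois (B.opMulSrc a x) = Tens.map B.η (orb H (B.s a)) LinearMap.id (B.galois x) :=
  Balanced.fun_ext (f := B.galois.comp (B.opMulSrc a))
    (g := (Tens.map B.η (orb H (B.s a)) LinearMap.id).comp B.galois) (fun b b' => by
      change B.galois (Balanced.tmul (b * B.s a) b') =
        Tens.map B.η (orb H (B.s a)) LinearMap.id (B.galois (Balanced.tmul b b'))
      rw [galois_tmul_eq, galois_tmul_eq, comul_mul_src, Tens.map_map, Tens.map_map]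
      rfl) x

/-- This is where the Takeuchi condition `b₁ ā ⊗ b₂ = b₁ ⊗ b₂ a` enters. -/
theorem galois_opSrcMul (a : A) (x : B.TensOp) :
    B.galois (B.opSrcMul a x) = Tens.map B.η (orb H (B.t a)) LinearMap.id (B.galois x) :=
  Balanced.fun_ext (f := B.galois.comp (B.opSrcMul a))
    (g := (Tens.map B.η (orb H (B.t a)) LinearMap.id).comp B.galois) (fun b b' => by
      change B.galois (Balanced.tmul b (B.s a * b')) =
        Tens.map B.η (orb H (B.t a)) LinearMap.id (B.galois (Balanced.tmul b b'))
      have h := congrArg (Tens.map B.η LinearMap.id (orb H b')) (B.coring.takeuchi a b)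
      rw [Tens.map_map, Tens.map_map] at h
      rw [galois_tmul_eq, galois_tmul_eq, Tens.map_map]
      refine Eq.trans ?_ h.symm
      congr 2
      ext; simp) x

theorem galois_opMulRight (c : H) (x : B.TensOp) :
    B.galois (B.opMulRight c x) = Tens.map B.η LinearMap.id (orb H c) (B.galois x) :=
  Balanced.fun_ext (f := B.galois.comp (B.opMulRight c))
    (g := (Tens.map B.η LinearMap.id (orb H c)).comp B.galois) (fun b b' => by
      change B.galois (Balanced.tmul b (b' * c)) =
        Tens.map B.η LinearMap.id (orb H c) (B.galois (Balanced.tmul b b'))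
      rw [galois_tmul_eq, galois_tmul_eq, Tens.map_map]
      congr 2
      ext; simp) x

variable {B} (hB : B.IsLeftHopf)

/-- `β⁻¹`, as an additive map. -/
def galoisInv : Tens B.η H H →+ B.TensOp :=
  (AddEquiv.ofBijective B.galois hB).symm.toAddMonoidHom

theorem galois_galoisInv (x : Tens B.η H H) : B.galois (galoisInv hB x) = x :=
  (AddEquiv.ofBijective B.galois hB).apply_symm_apply x

theorem galoisInv_eq {x : Tens B.η H H} {y : B.TensOp} (h : B.galois y = x) :
    galoisInv hB x = y :=
  hB.1 ((galois_galoisInv hB x).trans h.symm)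

theorem galoisInv_map_id_orb (c : H) (x : Tens B.η H H) :
    galoisInv hB (Tens.map B.η LinearMap.id (orb H c) x) = B.opMulRight c (galoisInv hB x) :=
  galoisInv_eq hB (by rw [galois_opMulRight, galois_galoisInv])

theorem galoisInv_mul_src (h : H) (a : A) :
    galoisInv hB (Tens.tmul B.η (h * B.s a) 1) =
      B.opMulSrc a (galoisInv hB (Tens.tmul B.η h 1)) :=
  galoisInv_eq hB (by rw [galois_opMulSrc, galois_galoisInv]; rfl)

theorem galoisInv_mul_tgt (h : H) (a : A) :
    galoisInv hB (Tens.tmul B.η (h * B.t a) 1) =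
      B.opSrcMul a (galoisInv hB (Tens.tmul B.η h 1)) :=
  galoisInv_eq hB (by rw [galois_opSrcMul, galois_galoisInv]; rfl)

theorem galoisInv_tmul (h c : H) :
    galoisInv hB (Tens.tmul B.η h c) = B.opMulRight c (galoisInv hB (Tens.tmul B.η h 1)) := by
  rw [← galoisInv_map_id_orb, Tens.map_tmul]
  congr 2
  exact (one_mul c).symm

theorem galoisInv_tgt_mul (h : H) (a : A) :
    galoisInv hB (Tens.tmul B.η (B.t a * h) 1) =
      B.opMulRight (B.s a) (galoisInv hB (Tens.tmul B.η h 1)) := by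
  rw [← galoisInv_tmul]
  congr 1
  exact (Tens.balance B.η a h 1).trans (congrArg (Tens.tmul B.η h) (mul_one (B.s a)))

/-! ### The lax braiding -/

section Braid

variable {M : Type u} [AddCommGroup M] [Module H M]

variable (B) in
/-- The map `b ⊗ b' ↦ b (b' m ⊗ (1 ⊠ 1))`. -/
def laxBraidPre (m : M) : B.TensOp →+ Tens B.η M B.Box :=
  Balanced.lift
    (AddMonoidHom.mk' (fun b => AddMonoidHom.mk'
        (fun b' => b • Tens.tmul B.η (b' • m) (B.boxTmul 1 1))
        (fun b' c' => by rw [add_smul, ← smul_add]; congr 1; exact Balanced.add_tmul _ _ _))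
      (fun b c => by ext b'; exact add_smul _ _ _))
    (fun a b b' => by
      change (b * B.t a) • Tens.tmul B.η (b' • m) (B.boxTmul 1 1) =
        b • Tens.tmul B.η ((B.t a * b') • m) (B.boxTmul 1 1)
      rw [mul_smul, tgt_smul_tmul, ← src_smul_box_one, ← Tens.balance, mul_smul])

theorem laxBraidPre_tmul (m : M) (b b' : H) :
    B.laxBraidPre m (Balanced.tmul b b') = b • Tens.tmul B.η (b' • m) (B.boxTmul 1 1) := rfl

theorem laxBraidPre_add (m m' : M) (x : B.TensOp) :
    B.laxBraidPre (m + m') x = B.laxBraidPre m x + B.laxBraidPre m' x :=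
  Balanced.fun_ext (f := B.laxBraidPre (m + m')) (g := B.laxBraidPre m + B.laxBraidPre m')
    (fun b b' => by
      rw [AddMonoidHom.add_apply, laxBraidPre_tmul, laxBraidPre_tmul, laxBraidPre_tmul, smul_add,
        ← smul_add b]
      congr 1
      exact Balanced.add_tmul _ _ _) x

theorem laxBraidPre_opMulRight (m : M) (c : H) (x : B.TensOp) :
    B.laxBraidPre m (B.opMulRight c x) = B.laxBraidPre (c • m) x :=
  Balanced.fun_ext (f := (B.laxBraidPre m).comp (B.opMulRight c)) (g := B.laxBraidPre (c • m))
    (fun b b' => by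
      change b • Tens.tmul B.η ((b' * c) • m) (B.boxTmul 1 1) = _
      rw [laxBraidPre_tmul, mul_smul]) x

theorem laxBraidPre_opMulSrc (m : M) (a : A) (x : B.TensOp) :
    B.laxBraidPre m (B.opMulSrc a x) = B.laxBraidPre m (B.opSrcMul a x) :=
  Balanced.fun_ext (f := (B.laxBraidPre m).comp (B.opMulSrc a))
    (g := (B.laxBraidPre m).comp (B.opSrcMul a))
    (fun b b' => by
      change (b * B.s a) • Tens.tmul B.η (b' • m) (B.boxTmul 1 1) =
        b • Tens.tmul B.η ((B.s a * b') • m) (B.boxTmul 1 1)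
      rw [mul_smul, src_smul_tmul, mul_smul]) x

/-- The map `(h, m) ↦ ∑ b (b' m ⊗ (1 ⊠ 1))`, where `∑ b ⊗ b' = β⁻¹(h ⊗ 1)`. -/
def laxBraidFun : H →+ M →+ Tens B.η M B.Box :=
  AddMonoidHom.mk' (fun h => AddMonoidHom.mk'
      (fun m => B.laxBraidPre m (galoisInv hB (Tens.tmul B.η h 1)))
      (fun m m' => laxBraidPre_add m m' _))
    (fun h h' => by
      ext m
      change B.laxBraidPre m (galoisInv hB (Tens.tmul B.η (h + h') 1)) =
        B.laxBraidPre m (galoisInv hB (Tens.tmul B.η h 1)) +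
          B.laxBraidPre m (galoisInv hB (Tens.tmul B.η h' 1))
      rw [← map_add, ← map_add, ← Balanced.add_tmul])

theorem laxBraidFun_apply (h : H) (m : M) :
    laxBraidFun hB h m = B.laxBraidPre m (galoisInv hB (Tens.tmul B.η h 1)) := rfl

theorem laxBraidFun_mul_tgt (h : H) (a : A) :
    (laxBraidFun hB (h * B.t a) : M →+ _) = laxBraidFun hB (h * B.s a) := by
  ext m
  rw [laxBraidFun_apply, laxBraidFun_apply, galoisInv_mul_tgt, galoisInv_mul_src,
    laxBraidPre_opMulSrc]

theorem laxBraidFun_tgt_mul (h : H) (a : A) (m : M) :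
    laxBraidFun hB (B.t a * h) m = laxBraidFun hB h (B.s a • m) := by
  rw [laxBraidFun_apply, laxBraidFun_apply, galoisInv_tgt_mul, laxBraidPre_opMulRight]

/-- The map of `laxBraidFun`, on `H ⊠ A`. -/
def laxBraidBox : B.Box →+ M →+ Tens B.η M B.Box :=
  Balanced.lift
    (AddMonoidHom.mk' (fun h => AddMonoidHom.mk' (fun a => laxBraidFun hB (h * B.s a))
        (fun a b => by rw [s, src_add, mul_add, map_add]))
      (fun h h' => by
        ext1 a
        change laxBraidFun hB ((h + h') * B.s a) =
          laxBraidFun hB (h * B.s a) + laxBraidFun hB (h' * B.s a)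
        rw [add_mul, map_add]))
    (fun r h a => by
      change laxBraidFun hB (h * (B.s r.1 * B.t r.2) * B.s a) =
        laxBraidFun hB (h * B.s (r.1 * (a * r.2)))
      rw [mul_src_tgt_src, laxBraidFun_mul_tgt, mul_src_src_src])

/-- The lax braiding `(H ⊠ A) ⊗ M → M ⊗ (H ⊠ A)`, as an additive map. -/
def laxBraidAdd : Tens B.η B.Box M →+ Tens B.η M B.Box :=
  Balanced.lift (laxBraidBox hB) (fun r x m => Balanced.fun_ext
    (f := (laxBraidBox hB).flip m |>.comp (rAct B.η B.Box r))
    (g := (laxBraidBox hB).flip (B.s r • m))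
    (fun h a => by
      change laxBraidFun hB (B.t r * h * B.s a) m = laxBraidFun hB (h * B.s a) (B.s r • m)
      rw [mul_assoc, laxBraidFun_tgt_mul]) x)

theorem laxBraidAdd_tmul (h : H) (a : A) (m : M) :
    laxBraidAdd hB (Tens.tmul B.η (B.boxTmul h a) m) = laxBraidFun hB (h * B.s a) m := rfl

theorem laxBraidAdd_map_orb (m : M) (x : Tens B.η H H) :
    laxBraidAdd hB (Tens.map B.η (orb H (B.boxTmul 1 1)) (orb H m) x) =
      B.laxBraidPre m (galoisInv hB x) :=
  Balanced.fun_ext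
    (f := (laxBraidAdd hB).comp (Tens.map B.η (orb H (B.boxTmul 1 1)) (orb H m)))
    (g := (B.laxBraidPre m).comp (galoisInv hB)) (fun h c => by
      change laxBraidFun hB (h * 1 * B.s 1) (c • m) =
        B.laxBraidPre m (galoisInv hB (Tens.tmul B.η h c))
      rw [galoisInv_tmul, laxBraidPre_opMulRight, mul_one, s, src_one, mul_one]
      rfl) x

variable (B) in
theorem map_orb_galois_tmul (m : M) (b b' : H) :
    Tens.map B.η (orb H (B.boxTmul 1 1)) (orb H m) (B.galois (Balanced.tmul b b')) =
      b • Tens.tmul B.η (B.boxTmul 1 1) (b' • m) := by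
  rw [galois_tmul_eq, Tens.map_map, smul_tmul]
  congr 2
  ext; simp

theorem laxBraidAdd_smul_unit_tmul (b : H) (m : M) :
    laxBraidAdd hB (b • Tens.tmul B.η (B.boxTmul 1 1) m) =
      b • Tens.tmul B.η m (B.boxTmul 1 1) := by
  have h := laxBraidAdd_map_orb hB m (B.galois (Balanced.tmul b 1))
  rw [galoisInv_eq hB rfl, map_orb_galois_tmul, laxBraidPre_tmul, one_smul] at h
  exact h

/-- If `β` is surjective, then the elements `b ((1 ⊠ 1) ⊗ m)` generate `(H ⊠ A) ⊗ M`. -/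
theorem tens_box_hom_ext (hs : Function.Surjective B.galois) {P : Type*} [AddCommGroup P]
    {f g : Tens B.η B.Box M →+ P}
    (h : ∀ (b : H) (m : M), f (b • Tens.tmul B.η (B.boxTmul 1 1) m) =
      g (b • Tens.tmul B.η (B.boxTmul 1 1) m)) : f = g := by
  refine Balanced.hom_ext fun x m => Balanced.fun_ext
    (f := f.comp ((Balanced.mk₂ (rAct B.η B.Box) (lAct B.η M)).flip m))
    (g := g.comp ((Balanced.mk₂ (rAct B.η B.Box) (lAct B.η M)).flip m)) (fun c a => ?_) x
  change f (Tens.tmul B.η (B.boxTmul c a) m) = g (Tens.tmul B.η (B.boxTmul c a) m)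
  obtain ⟨y, hy⟩ := hs (Tens.tmul B.η (c * B.s a) 1)
  have e : Tens.tmul B.η (B.boxTmul c a) m =
      Tens.map B.η (orb H (B.boxTmul 1 1)) (orb H m) (B.galois y) := by
    rw [hy, Tens.map_tmul, boxTmul_eq_smul, LinearMap.toSpanSingleton_apply,
      LinearMap.toSpanSingleton_apply, one_smul]
  rw [e]
  exact Balanced.fun_ext
    (f := f.comp ((Tens.map B.η (orb H (B.boxTmul 1 1)) (orb H m)).comp B.galois))
    (g := g.comp ((Tens.map B.η (orb H (B.boxTmul 1 1)) (orb H m)).comp B.galois))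
    (fun b b' => by
      change f (Tens.map B.η _ _ (B.galois (Balanced.tmul b b'))) =
        g (Tens.map B.η _ _ (B.galois (Balanced.tmul b b')))
      rw [map_orb_galois_tmul, h]) y

/-- The lax braiding `(H ⊠ A) ⊗ M → M ⊗ (H ⊠ A)`, as an `H`-linear map. -/
def laxBraidLin : Tens B.η B.Box M →ₗ[H] Tens B.η M B.Box where
  toFun := laxBraidAdd hB
  map_add' := map_add _
  map_smul' c := DFunLike.congr_fun (tens_box_hom_ext hB.2
    (f := (laxBraidAdd hB).comp (DistribSMul.toAddMonoidHom (Tens B.η B.Box M) c))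
    (g := (DistribSMul.toAddMonoidHom (Tens B.η M B.Box) c).comp (laxBraidAdd hB))
    (fun b m => by
      change laxBraidAdd hB (c • b • Tens.tmul B.η (B.boxTmul 1 1) m) =
        c • laxBraidAdd hB (b • Tens.tmul B.η (B.boxTmul 1 1) m)
      rw [← mul_smul, laxBraidAdd_smul_unit_tmul, laxBraidAdd_smul_unit_tmul, mul_smul]))

theorem laxBraidLin_unit_tmul (m : M) :
    laxBraidLin hB (Tens.tmul B.η (B.boxTmul 1 1) m) = Tens.tmul B.η m (B.boxTmul 1 1) := by
  have h := laxBraidAdd_smul_unit_tmul hB 1 m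
  rw [one_smul, one_smul] at h
  exact h

/-- The formula `(h ⊠ a) ⊗ m ↦ (h₊₁ a h₋) m ⊗ (h₊₂ ⊠ 1)`. -/
theorem laxBraidLin_tmul (h : H) (a : A) (m : M) (n : ℕ) (p q : Fin n → H)
    (hpq : B.galois (∑ i, Balanced.tmul (p i) (q i)) = Tens.tmul B.η h 1) :
    laxBraidLin hB (Tens.tmul B.η (B.boxTmul h a) m) =
      ∑ i, Tens.map B.η (orb H ((B.s a * q i) • m)) (orb H (B.boxTmul 1 1))
        (B.coring.comul (p i)) := by
  change laxBraidAdd hB (Tens.tmul B.η (B.boxTmul h a) m) = _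
  rw [laxBraidAdd_tmul, laxBraidFun_apply, galoisInv_mul_src, laxBraidPre_opMulSrc,
    galoisInv_eq hB hpq, map_sum, map_sum]
  refine Finset.sum_congr rfl fun i _ => ?_
  rw [opSrcMul_tmul, laxBraidPre_tmul, smul_tmul]

end Braid

/-- If `β` is surjective, then morphisms out of `(H ⊠ A) ⊗ M` are determined by their values at the
elements `(1 ⊠ 1) ⊗ m`. -/
theorem induced_tensor_hom_ext (hs : Function.Surjective B.galois) {M N : B.Rep}
    {f g : B.induced ⊗ M ⟶ N}
    (h : ∀ m : M, lin f (B.tmul (B.box 1 1) m) = lin g (B.tmul (B.box 1 1) m)) : f = g :=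
  rep_ext (LinearMap.toAddMonoidHom_injective (tens_box_hom_ext (B := B) (M := M) hs fun b m =>
    (map_smul (lin f) b _).trans
      ((congrArg (b • ·) (h m)).trans (map_smul (lin g) b _).symm)))

/-- The component at `M` of the lax braiding. -/
def laxBraidHom (M : B.Rep) : B.induced ⊗ M ⟶ M ⊗ B.induced :=
  B.mor (M := B.induced ⊗ M) (N := M ⊗ B.induced) (laxBraidLin (M := M) hB)

theorem lin_laxBraidHom_unit_tmul (M : B.Rep) (m : M) :
    lin (laxBraidHom hB M) (B.tmul (B.box 1 1) m) = B.tmul m (B.box 1 1) :=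
  laxBraidLin_unit_tmul hB m

/-- The lax braiding of `H ⊠ A`, determined by `(1 ⊠ 1) ⊗ m ↦ m ⊗ (1 ⊠ 1)`. -/
def inducedLaxBraiding : LaxBraiding B.induced where
  τ := laxBraidHom hB
  naturality f := induced_tensor_hom_ext hB.2 fun m => by
    rw [lin_comp_apply, lin_comp_apply, lin_whiskerLeft_tmul, lin_laxBraidHom_unit_tmul,
      lin_laxBraidHom_unit_tmul, lin_whiskerRight_tmul]
  tensor Y Z := induced_tensor_hom_ext hB.2 fun x => by
    rw [lin_laxBraidHom_unit_tmul]
    exact Balanced.fun_ext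
      (f := (Balanced.mk₂ (rAct B.η (Tens B.η Y Z)) (lAct B.η B.Box)).flip (B.boxTmul 1 1))
      (g := (lin ((α_ B.induced Y Z).inv ≫ laxBraidHom hB Y ▷ Z ≫ (α_ Y B.induced Z).hom ≫
        Y ◁ laxBraidHom hB Z ≫ (α_ Y Z B.induced).inv)).toAddMonoidHom.comp
          (Balanced.mk₂ (rAct B.η B.Box) (lAct B.η (Tens B.η Y Z)) (B.boxTmul 1 1)))
      (fun y z => by
        change B.tmul (B.tmul y z) (B.box 1 1) =
          lin ((α_ B.induced Y Z).inv ≫ laxBraidHom hB Y ▷ Z ≫ (α_ Y B.induced Z).hom ≫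
            Y ◁ laxBraidHom hB Z ≫ (α_ Y Z B.induced).inv)
              (B.tmul (B.box 1 1) (B.tmul y z))
        rw [lin_comp_apply, lin_comp_apply, lin_comp_apply, lin_comp_apply,
          lin_associator_inv_tmul, lin_whiskerRight_tmul, lin_laxBraidHom_unit_tmul,
          lin_associator_hom_tmul, lin_whiskerLeft_tmul, lin_laxBraidHom_unit_tmul,
          lin_associator_inv_tmul]) x
  unit := induced_tensor_hom_ext hB.2 fun a => by
    rw [lin_laxBraidHom_unit_tmul, lin_comp_apply]
    -- Both sides equal `(1 a) ⊗ u = 1 ⊗ a u = 1 ⊗ ā u`, where `u = 1 ⊠ 1`.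
    change Tens.tmul B.η a (B.boxTmul 1 1) =
      Tens.tmul B.η (B.toBase 1) (B.t (B.ofBase a) • B.boxTmul 1 1)
    rw [← src_smul_box_one, ← Tens.balance]
    congr 1
    exact ((B.tgt_smul_base (B.ofBase a) (B.toBase 1)).trans (one_mul _)).symm

/-- With the lax braiding, `H ⊠ A` is a cocommutative lax central coalgebra. -/
theorem inducedLaxBraiding_isLaxCCC :
    let _ := B.inducedComon
    (inducedLaxBraiding hB).IsLaxCCC :=
  letI := B.inducedComon
  { comul := fun Y => induced_tensor_hom_ext hB.2 fun m => by
      change lin (B.inducedComul ▷ Y ≫ (α_ B.induced B.induced Y).hom ≫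
        B.induced ◁ laxBraidHom hB Y ≫ (α_ B.induced Y B.induced).inv ≫
          laxBraidHom hB Y ▷ B.induced ≫ (α_ Y B.induced B.induced).hom) _ =
        lin (laxBraidHom hB Y ≫ Y ◁ B.inducedComul) _
      rw [lin_comp_apply, lin_comp_apply, lin_comp_apply, lin_comp_apply, lin_comp_apply,
        lin_comp_apply, lin_whiskerRight_tmul, lin_inducedComul_box_one,
        lin_associator_hom_tmul, lin_whiskerLeft_tmul, lin_laxBraidHom_unit_tmul,
        lin_associator_inv_tmul, lin_whiskerRight_tmul, lin_laxBraidHom_unit_tmul,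
        lin_associator_hom_tmul, lin_whiskerLeft_tmul, lin_inducedComul_box_one]
    counit := fun Y => induced_tensor_hom_ext hB.2 fun m => by
      change lin (laxBraidHom hB Y ≫ Y ◁ B.inducedCounit ≫ (ρ_ Y).hom) _ =
        lin (B.inducedCounit ▷ Y ≫ (λ_ Y).hom) _
      rw [lin_comp_apply, lin_comp_apply, lin_comp_apply, lin_laxBraidHom_unit_tmul,
        lin_whiskerLeft_tmul, lin_whiskerRight_tmul, lin_inducedCounit_box_one,
        lin_rightUnitor_hom_tmul, lin_leftUnitor_hom_tmul, s, t, src_one, tgt_one]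
    cocomm := B.induced_hom_ext (by
      change lin (B.inducedComul ≫ laxBraidHom hB B.induced) _ = lin B.inducedComul _
      rw [lin_comp_apply, lin_inducedComul_box_one, lin_laxBraidHom_unit_tmul]) }

end LeftBialgebroid

end HopfAlgebroid

end

theorem mainTheorem12 {k : Type v} {A H : Type u} [Field k] [Ring A] [Algebra k A] [Ring H]
    [Algebra k H] (B : HopfAlgebroid.LeftBialgebroid k A H) :
    -- `H ⊠ A` is the quotient of `H` by the left ideal generated by the elements `a - ā`
    (∃ e : B.induced ≃ₗ[H] H ⧸ B.leftIdeal,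
      ∀ h a, e (B.box h a) = B.leftIdeal.mkQ (h * B.s a)) ∧
    -- `Δ` and `ε` descend to a coalgebra structure on `H ⊠ A` in the category of `H`-modules:
    -- `ε (h ⊠ a) = ε(h a)` and `Δ (h ⊠ a) = (h₁ ⊠ a) ⊗ (h₂ ⊠ 1)`
    ∃ _ : ComonObj B.induced,
      (∀ h a, HopfAlgebroid.LeftBialgebroid.lin (ComonObj.counit (X := B.induced)) (B.box h a) =
        B.toBase (B.coring.counit (h * B.s a))) ∧
      (∀ h a, HopfAlgebroid.LeftBialgebroid.lin (ComonObj.comul (X := B.induced)) (B.box h a) =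
        B.onTens (HopfAlgebroid.orb H (B.box 1 a)) (HopfAlgebroid.orb H (B.box 1 1))
          (B.coring.comul h)) ∧
      -- if `H` is left Hopf, then, with `h₊ ⊗ h₋ = ∑ᵢ pᵢ ⊗ qᵢ` the preimage of `h ⋄ 1` under `β`,
      -- `(h ⊠ a) ⊗ m ↦ ∑ᵢ (pᵢ)₁ a qᵢ m ⊗ ((pᵢ)₂ ⊠ 1)` is a lax braiding, and `H ⊠ A` is a
      -- cocommutative lax central coalgebra
      (B.IsLeftHopf → ∃ σ : HopfAlgebroid.LaxBraiding B.induced,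
        (∀ (M : B.Rep) (h : H) (a : A) (m : M) (n : ℕ) (p q : Fin n → H),
          B.galois (∑ i, HopfAlgebroid.Balanced.tmul (p i) (q i)) =
            HopfAlgebroid.Tens.tmul B.η h 1 →
          HopfAlgebroid.LeftBialgebroid.lin (σ.τ M) (B.tmul (B.box h a) m) =
            ∑ i, B.onTens (HopfAlgebroid.orb H ((B.s a * q i) • m))
              (HopfAlgebroid.orb H (B.box 1 1)) (B.coring.comul (p i))) ∧
        σ.IsLaxCCC) := by
  exact ⟨⟨B.boxEquiv, B.boxEquiv_boxTmul⟩, B.inducedComon, B.lin_inducedCounit_box,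
    B.lin_inducedComul_box, fun hB =>
      ⟨HopfAlgebroid.LeftBialgebroid.inducedLaxBraiding hB,
        fun M h a m n p q hpq =>
          HopfAlgebroid.LeftBialgebroid.laxBraidLin_tmul (M := M) hB h a m n p q hpq,
        HopfAlgebroid.LeftBialgebroid.inducedLaxBraiding_isLaxCCC hB⟩⟩
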